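/- We work over $\mathbb C$, with varieties considered up to passing to dense open subsets. A \emph{parametric scroll} $X=X_B$ in $\mathbb P^N$ is a rational map $B\dashrightarrow \mathbb G(k,N)$, $b\mapsto X_b\cong\mathbb P^k$, $k\ge 0$, from an irreducible variety $B$, generically finite to its image. Its \emph{spreading map} $f$ maps the total space of the induced $\mathbb P^k$-bundle to $\mathbb P^N$; the scroll is called a hypersurface if the closure of the image of $f$ is one. $X_B$ is \emph{stationary} if, for general $b\in B$, the image of $d_xf$, regarded as a linear subspace of $\mathbb P^N$ (the embedded tangent space), is the same for all $x$ in a dense open subset of $X_b$. A parametric scroll $T_B$ over the same base is then the \emph{tangential} (or derived) scroll of $X_B$ if $T_b$ is this linear subspace for general $b$. The stationary scroll $X_B$ has \emph{Gauss dimension} $g$ if $\dim B=g$ and its Gauss map $b\mapsto T_b$ is generically finite to its image (so that the Gauss image has dimension $g$, and the tangential scroll is again a parametric scroll over $B$). The \emph{$i$-th osculating scroll} of $X_B$ is the end $X^{(i)}_B$ of a chain of parametric scrolls $X=X^{(0)},X^{(1)},\dots,X^{(i)}$ over $B$ in which each $X^{(j)}$ with $j<i$ is stationary and $X^{(j+1)}$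 is its tangential scroll. The \emph{linear dual} of $X_B$ is the scroll over $B$ in the dual projective space $\check{\mathbb P}^N$ whose fibre over a general $b$ is $X_b^\perp$. A generically finite rational map $Y$ from $B$ to a projective space is regarded as a scroll of fibre dimension $0$, and as a $g$-dimensional variety if the closure of its image has dimension $g$. Let $X=X_B$ be a stationary scroll in $\mathbb P^N$ of Gauss dimension $g$. (a) If $X$ is a hypersurface, then there is a $g$-dimensional variety $Y\colon B\dashrightarrow\check{\mathbb P}^N$ whose tangential scroll is the linear dual of $X$. (b) Let $i\ge 0$. If $X$ has an $i$-th osculating scroll $X^{(i)}$, and $X^{(i)}$ is a hypersurface and is itself stationary of Gauss dimension $g$, then there is a $g$-dimensional variety $Y\colon B\dashrightarrow\check{\mathbb P}^N$ which has an $(i+1)$-st osculating scroll that is the linear dual of $X$. -/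

import Mathlib

/-!
All varieties are over `ℂ`.  The base of a scroll is an irreducible variety `B`.  Everything below
depends only on a dense open subset of `B`, so `B` is taken affine: it is the zero locus in affine
`m`-space of a prime ideal `I`.  Linear subspaces of projective `N`-space are written as linear
subspaces of `ℂ ^ (N + 1)`, and subsets of projective `N`-space as cones in `ℂ ^ (N + 1)`.
-/

noncomputable section

namespace Scroll

open MvPolynomial

/-- `P b` holds for a general point `b` of the irreducible variety `B = V(I)`: it holds on a
nonempty (hence dense) basic Zariski-open subset of `B`. -/
def Generally {m : ℕ} (I : Ideal (MvPolynomial (Fin m) ℂ)) (P : (Fin m → ℂ) → Prop) : Prop :=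
  ∃ h : MvPolynomial (Fin m) ℂ, h ∉ I ∧ ∀ b ∈ zeroLocus ℂ I, aeval b h ≠ 0 → P b

/-- `P a` holds for a general point `a` of the vector space `ℂ ^ r`. -/
def GenerallyVec {r : ℕ} (P : (Fin r → ℂ) → Prop) : Prop :=
  ∃ q : MvPolynomial (Fin r) ℂ, q ≠ 0 ∧ ∀ a : Fin r → ℂ, aeval a q ≠ 0 → P a

/-- The derivative at `b` of the polynomial function `p`, in the direction `v`. -/
def dirDeriv {m : ℕ} (b v : Fin m → ℂ) (p : MvPolynomial (Fin m) ℂ) : ℂ :=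
  ∑ l, v l * aeval b (pderiv l p)

/-- The Zariski tangent space of `B = V(I)` at `b`, as a subspace of `ℂ ^ m`. -/
def tangentSpace {m : ℕ} (I : Ideal (MvPolynomial (Fin m) ℂ)) (b : Fin m → ℂ) :
    Submodule ℂ (Fin m → ℂ) where
  carrier := {v | ∀ p ∈ I, dirDeriv b v p = 0}
  zero_mem' := fun p _ => by simp [dirDeriv]
  add_mem' := fun {v w} hv hw p hp => by
    have h1 := hv p hp
    have h2 := hw p hp
    simp only [dirDeriv] at h1 h2 ⊢
    simp only [Pi.add_apply, add_mul, Finset.sum_add_distrib, h1, h2, add_zero]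
  smul_mem' := fun c v hv p hp => by
    have h1 := hv p hp
    simp only [dirDeriv] at h1 ⊢
    simp only [Pi.smul_apply, smul_eq_mul, mul_assoc, ← Finset.mul_sum, h1, mul_zero]

/-- The subset of projective `N`-space whose cone is `Z` has (Zariski closure of) dimension `d`:
the homogeneous coordinate ring of its closure has Krull dimension `d + 1`. -/
def HasProjDim {N : ℕ} (Z : Set (Fin (N + 1) → ℂ)) (d : ℕ) : Prop :=
  ringKrullDim (MvPolynomial (Fin (N + 1)) ℂ ⧸ vanishingIdeal ℂ Z) = ((d + 1 : ℕ) : WithBot ℕ∞)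

/-- The subspace of `ℂ ^ (N + 1)` spanned by the values at `b` of the polynomial vectors `s`. -/
def spanAt {m r N : ℕ} (s : Fin r → Fin (N + 1) → MvPolynomial (Fin m) ℂ) (b : Fin m → ℂ) :
    Submodule ℂ (Fin (N + 1) → ℂ) :=
  Submodule.span ℂ (Set.range fun j : Fin r => fun i => aeval b (s j i))

/-- A parametric scroll of fibre dimension `k ≥ 0` in projective `N`-space over `B = V(I)`: a
rational map from `B` to the Grassmannian of projective `k`-spaces which is generically finite to
its image.  A rational map to the Grassmannian is given by `k + 1` vectors of rational functions
on `B` that are linearly independent at a general point, and after clearing denominators by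
`k + 1` vectors of polynomials. -/
structure ParametricScroll {m : ℕ} (I : Ideal (MvPolynomial (Fin m) ℂ)) (N : ℕ) where
  /-- the dimension of the fibres, as projective spaces -/
  k : ℕ
  /-- a frame of the bundle of fibres -/
  frame : Fin (k + 1) → Fin (N + 1) → MvPolynomial (Fin m) ℂ
  /-- at a general point the frame spans a projective `k`-space -/
  indep : Generally I fun b => LinearIndependent ℂ fun j : Fin (k + 1) => fun i => aeval b (frame j i)
  /-- on some dense open subset of `B` the classifying map has finite fibres -/
  genFinite : ∃ h : MvPolynomial (Fin m) ℂ, h ∉ I ∧ ∀ b ∈ zeroLocus ℂ I, aeval b h ≠ 0 →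
    {b' | b' ∈ zeroLocus ℂ I ∧ aeval b' h ≠ 0 ∧ spanAt frame b' = spanAt frame b}.Finite

namespace ParametricScroll

variable {m : ℕ} {I : Ideal (MvPolynomial (Fin m) ℂ)} {N : ℕ}

/-- The fibre over `b` (a projective `k`-space for general `b`), as a subspace of
`ℂ ^ (N + 1)`. -/
def fibre (X : ParametricScroll I N) (b : Fin m → ℂ) : Submodule ℂ (Fin (N + 1) → ℂ) :=
  spanAt X.frame b

/-- The spreading map `(b, a) ↦ ∑ j, a j • (frame j) (b)`. -/
def spreadMap (X : ParametricScroll I N) (b : Fin m → ℂ) (a : Fin (X.k + 1) → ℂ) :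
    Fin (N + 1) → ℂ :=
  fun i => ∑ j, a j * aeval b (X.frame j i)

/-- The spread: (the cone over) the image of the spreading map. -/
def spread (X : ParametricScroll I N) : Set (Fin (N + 1) → ℂ) :=
  {x | ∃ b ∈ zeroLocus ℂ I, ∃ a, x = X.spreadMap b a}

/-- The differential of the spreading map at `(b, a)`. -/
def spreadDiff (X : ParametricScroll I N) (b : Fin m → ℂ) (a : Fin (X.k + 1) → ℂ) :
    ((Fin m → ℂ) × (Fin (X.k + 1) → ℂ)) →ₗ[ℂ] (Fin (N + 1) → ℂ) where
  toFun := fun w i =>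
    ∑ j, (w.2 j * aeval b (X.frame j i) + a j * dirDeriv b w.1 (X.frame j i))
  map_add' := fun w w' => by
    funext i
    simp only [dirDeriv, Prod.fst_add, Prod.snd_add, Pi.add_apply, add_mul,
      Finset.sum_add_distrib, mul_add]
    ring
  map_smul' := fun c w => by
    funext i
    simp only [dirDeriv, Prod.smul_fst, Prod.smul_snd, Pi.smul_apply, smul_eq_mul,
      RingHom.id_apply, Finset.mul_sum, mul_add, Finset.sum_add_distrib]
    congr 1
    · exact Finset.sum_congr rfl fun j _ => by ring
    · exact Finset.sum_congr rfl fun j _ => Finset.sum_congr rfl fun l _ => by ring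

/-- The image of the derivative of the spreading map at the point of `X` with base point `b` and
fibre coordinates `a`, as a linear subspace of projective `N`-space (that is, the embedded tangent
space, as a subspace of `ℂ ^ (N + 1)`). -/
def tangent (X : ParametricScroll I N) (b : Fin m → ℂ) (a : Fin (X.k + 1) → ℂ) :
    Submodule ℂ (Fin (N + 1) → ℂ) :=
  Submodule.map (X.spreadDiff b a) ((tangentSpace I b).prod ⊤)

/-- `X` is stationary: for general `b`, the image of the derivative of the spreading map is the
same at all points of a dense open subset of the fibre over `b`. -/
def IsStationary (X : ParametricScroll I N) : Prop :=
  Generally I fun b => ∃ W : Submodule ℂ (Fin (N + 1) → ℂ), GenerallyVec fun a => X.tangent b a = W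

/-- `T` is the derived (or tangential) scroll of the stationary scroll `X`: its fibre over a
general `b` is the embedded tangent space to `X` at a general point of the fibre over `b`. -/
def IsDerived (X T : ParametricScroll I N) : Prop :=
  X.IsStationary ∧ Generally I fun b => GenerallyVec fun a => T.fibre b = X.tangent b a

/-- `IsOsculating i X Z`: the scroll `Z` is the `i`-th osculating scroll of `X`, i.e. it is reached
from `X` by forming the derived scroll `i` times. -/
inductive IsOsculating : ℕ → ParametricScroll I N → ParametricScroll I N → Prop
  | zero (X : ParametricScroll I N) : IsOsculating 0 X X
  | succ {i : ℕ} {X Z T : ParametricScroll I N} :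
      IsOsculating i X Z → IsDerived Z T → IsOsculating (i + 1) X T

/-- The stationary scroll `X / B` has Gauss dimension `g`: `B` has dimension `g`, and the Gauss map
of `X`, which sends a general `b ∈ B` to the tangent space of `X` along the fibre over `b`, is
generically finite to its image (being the classifying map of a parametric scroll), so that its
image has dimension `g` too. -/
def HasGaussDim (X : ParametricScroll I N) (g : ℕ) : Prop :=
  ringKrullDim (MvPolynomial (Fin m) ℂ ⧸ I) = (g : WithBot ℕ∞) ∧
    ∃ T : ParametricScroll I N, X.IsDerived T

/-- The spread of `X` (which is irreducible) has codimension one in projective `N`-space. -/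
def IsHypersurface (X : ParametricScroll I N) : Prop :=
  ∃ d : ℕ, d + 1 = N ∧ HasProjDim X.spread d

/-- `W`, a scroll over the same base in the dual projective space, is the linear dual of `X`: its
fibre over a general `b` consists of the linear forms vanishing on the fibre of `X`.  A linear form
is written through its coefficient vector `ξ`. -/
def IsLinearDual (X W : ParametricScroll I N) : Prop :=
  Generally I fun b => ∀ ξ : Fin (N + 1) → ℂ, ξ ∈ W.fibre b ↔ ∀ x ∈ X.fibre b, ξ ⬝ᵥ x = 0

/-- `Y` is a scroll of fibre dimension `0`, i.e. a generically finite map from `B` to projective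
space, and the closure of its image is a variety of dimension `g`. -/
def IsVarietyOfDim (Y : ParametricScroll I N) (g : ℕ) : Prop :=
  Y.k = 0 ∧ HasProjDim Y.spread g

end ParametricScroll

end Scroll

end

/-! Pass to the generic point of the base. Let K be the function field of B. A scroll becomes a
subspace U of K^(N+1), and the tangential scroll becomes U' = U + Der(K)·U. Stationarity says that a
single u ∈ U already gives U' = U + Der(K)u (`IsDerivedSpace`). The linear dual is the orthogonal
complement for the dot product. `IsDerived.isDerivedSpace` and `isDerived_of_isDerivedSpace`
translate in both directions, so the theorem becomes linear algebra with derivations.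

The central object is a second fundamental form: for η ⟂ U' and x ∈ U, the pairing (D, E) ↦ η·D(Ex),
which is symmetric because η kills [D, E]x. If it is nondegenerate, D ↦ Dη is injective modulo U'^⊥.
Moreover Dη ∈ U^⊥, and dim U' - dim U ≤ dim Der(K), so counting dimensions gives U^⊥ = U'^⊥ +
Der(K)η. Thus U^⊥ is the derived space of U'^⊥ (`IsDerivedSpace.perp`).

For a stationary hypersurface U' is a hyperplane: tangent spaces are killed by the gradient of an
equation of the spread, and in characteristic zero their dimension is at least that of the cone over
the spread. Then U'^⊥ = Kη is the dual variety Y. The Gauss map is generically finite, so K is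
algebraic over the field generated by the ratios of coordinates of η, and Dη ∈ Kη forces D = 0. The
same dimension count then yields nondegeneracy for some x, which proves (a).

For (b), nondegeneracy descends an osculating chain U, U', U''. If η ⟂ U'' pairs nondegenerately
with x = w + D₀u, where u, w ∈ U, then D₀η pairs nondegenerately with u, because D₀η·D(Eu) =
-η·D(Ex). Hence each step of the chain dualises to a step in the opposite direction. -/

noncomputable section

namespace Scroll

open MvPolynomial

set_option linter.unusedSectionVars false

/-! ### Orthogonal complements for the dot product. -/

section LinearAlgebra

variable {K : Type*} [Field K] {n : Type*} [Fintype n]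

/-- The orthogonal complement of `U` with respect to the dot product. -/
def perp (U : Submodule K (n → K)) : Submodule K (n → K) where
  carrier := {ξ | ∀ x ∈ U, ξ ⬝ᵥ x = 0}
  zero_mem' := fun x _ => zero_dotProduct x
  add_mem' := fun {a b} ha hb x hx => by rw [add_dotProduct, ha x hx, hb x hx, add_zero]
  smul_mem' := fun c a ha x hx => by rw [smul_dotProduct, ha x hx, smul_zero]

theorem perp_antitone {U V : Submodule K (n → K)} (h : U ≤ V) : perp V ≤ perp U :=
  fun _ hξ x hx => hξ x (h hx)

theorem dotProductBilin_isSymm :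
    (dotProductBilin K K : LinearMap.BilinForm K (n → K)).IsSymm :=
  ⟨fun x y => dotProduct_comm x y⟩

theorem dotProductBilin_nondegenerate :
    (dotProductBilin K K : LinearMap.BilinForm K (n → K)).Nondegenerate := by
  classical
  refine (LinearMap.IsSymm.isRefl dotProductBilin_isSymm).nondegenerate_iff_separatingLeft.2
    fun x hx => dotProduct_eq_zero x hx

theorem perp_eq_orthogonal (U : Submodule K (n → K)) :
    perp U = LinearMap.BilinForm.orthogonal (dotProductBilin K K) U := by
  ext ξ
  refine forall₂_congr fun x _ => ?_
  change _ ↔ x ⬝ᵥ ξ = 0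
  rw [dotProduct_comm]

theorem perp_perp (U : Submodule K (n → K)) : perp (perp U) = U := by
  rw [perp_eq_orthogonal, perp_eq_orthogonal]
  exact LinearMap.BilinForm.orthogonal_orthogonal dotProductBilin_nondegenerate
    (LinearMap.IsSymm.isRefl dotProductBilin_isSymm) U

theorem finrank_add_finrank_perp (U : Submodule K (n → K)) :
    Module.finrank K U + Module.finrank K (perp U) = Fintype.card n := by
  have h := LinearMap.BilinForm.finrank_orthogonal
    (dotProductBilin_nondegenerate (K := K) (n := n)) U
  have h2 := Submodule.finrank_le U
  rw [Module.finrank_fintype_fun_eq_card] at h h2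
  rw [perp_eq_orthogonal, h]
  omega

end LinearAlgebra

/-! ### Derived spaces over a field with derivations, and their duality. -/

section Derivations

variable {F K : Type*} [Field F] [Field K] [Algebra F K] {n : Type*}

/-- A derivation applied to each coordinate of a vector. -/
def derVec (D : Derivation F K K) (x : n → K) : n → K := fun i => D (x i)

theorem derVec_add (D : Derivation F K K) (x y : n → K) :
    derVec D (x + y) = derVec D x + derVec D y := funext fun _ => map_add D _ _

theorem derVec_smul (D : Derivation F K K) (c : K) (x : n → K) :
    derVec D (c • x) = c • derVec D x + D c • x := by
  funext i
  simp only [derVec, Pi.smul_apply, Pi.add_apply, D.leibniz, smul_eq_mul]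
  ring

theorem derVec_commutator (D E : Derivation F K K) (x : n → K) :
    derVec D (derVec E x) = derVec E (derVec D x) + derVec ⁅D, E⁆ x := by
  funext i
  simp only [derVec, Pi.add_apply, Derivation.commutator_apply]
  ring

theorem derivation_dotProduct [Fintype n] (D : Derivation F K K) (x y : n → K) :
    D (x ⬝ᵥ y) = derVec D x ⬝ᵥ y + x ⬝ᵥ derVec D y := by
  simp only [dotProduct, map_sum, D.leibniz, smul_eq_mul, derVec, ← Finset.sum_add_distrib]
  exact Finset.sum_congr rfl fun i _ => by ring

/-- The linear map `D ↦ D x`. -/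
def derAt (F : Type*) [Field F] [Algebra F K] (x : n → K) : Derivation F K K →ₗ[K] (n → K) where
  toFun := fun D => derVec D x
  map_add' := fun _ _ => rfl
  map_smul' := fun _ _ => rfl

/-- `U'` is the derived space of `U`, and it is already generated over `U` by the derivatives of a
single vector. -/
structure IsDerivedSpace (F : Type*) [Field F] [Algebra F K] (U U' : Submodule K (n → K)) :
    Prop where
  le : U ≤ U'
  derVec_mem : ∀ u ∈ U, ∀ D : Derivation F K K, derVec D u ∈ U'
  exists_gen : ∃ u ∈ U, U' ≤ U ⊔ LinearMap.range (derAt F u)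

/-- The pairing `(D, E) ↦ η ⬝ D (E x)` of derivations has no right kernel. -/
def HasNondegeneratePairing (F : Type*) [Field F] [Algebra F K] [Fintype n] (η x : n → K) : Prop :=
  ∀ E : Derivation F K K, (∀ D : Derivation F K K, η ⬝ᵥ derVec D (derVec E x) = 0) → E = 0

variable [Fintype n] {U U' U'' : Submodule K (n → K)} {η x : n → K}

theorem IsDerivedSpace.derVec_mem_perp (h : IsDerivedSpace F U U') (hη : η ∈ perp U')
    (D : Derivation F K K) : derVec D η ∈ perp U := fun y hy => by
  have h1 := derivation_dotProduct D η y
  rw [hη y (h.le hy), map_zero, hη _ (h.derVec_mem y hy D), add_zero] at h1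
  exact h1.symm

/-- Write `x = w + D₀ u` with `u, w ∈ U`, and take `η' = D₀ η`. Two derivatives of a vector of `U`
lie in `U''`, which `η` kills. So in `η·D(E x)` the part `w` drops out, `D₀` may be moved to the
front, and the Leibniz rule shifts it onto `η` with a change of sign. -/
theorem IsDerivedSpace.exists_nondegeneratePairing_pred (h : IsDerivedSpace F U U')
    (h' : IsDerivedSpace F U' U'') (hη : η ∈ perp U'') (hx : x ∈ U')
    (hnd : HasNondegeneratePairing F η x) :
    ∃ η' ∈ perp U', ∃ u ∈ U, HasNondegeneratePairing F η' u := by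
  obtain ⟨u, hu, hgen⟩ := h.exists_gen
  obtain ⟨w, hw, _, ⟨D₀, rfl⟩, rfl⟩ := Submodule.mem_sup.1 (hgen hx)
  refine ⟨derVec D₀ η, h'.derVec_mem_perp hη D₀, u, hu, fun E hE => hnd E fun D => ?_⟩
  have mem₂ : ∀ y ∈ U, ∀ A B : Derivation F K K, derVec A (derVec B y) ∈ U'' := fun y hy A B =>
    h'.derVec_mem _ (h.derVec_mem y hy B) A
  have h1 : η ⬝ᵥ derVec D (derVec E (derAt F u D₀)) =
      η ⬝ᵥ derVec D₀ (derVec D (derVec E u)) := by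
    change η ⬝ᵥ derVec D (derVec E (derVec D₀ u)) = _
    rw [derVec_commutator E D₀, derVec_add, derVec_commutator D D₀, dotProduct_add,
      dotProduct_add, hη _ (h'.derVec_mem _ (h.derVec_mem u hu E) _), hη _ (mem₂ u hu _ _),
      add_zero, add_zero]
  have h2 := derivation_dotProduct D₀ η (derVec D (derVec E u))
  rw [hη _ (mem₂ u hu _ _), map_zero, hE D, zero_add] at h2
  rw [derVec_add, derVec_add, dotProduct_add, hη _ (mem₂ w hw _ _), h1, ← h2, add_zero]

theorem finrank_sup_range_derAt {V : Submodule K (n → K)}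
    (h : ∀ D : Derivation F K K, derVec D x ∈ V → D = 0) :
    Module.finrank K ↥(V ⊔ LinearMap.range (derAt F x)) =
      Module.finrank K V + Module.finrank K (Derivation F K K) := by
  have h1 : V ⊓ LinearMap.range (derAt F x) = ⊥ := by
    refine (Submodule.eq_bot_iff _).2 ?_
    rintro _ ⟨hV, D, rfl⟩
    rw [h D hV, map_zero]
  have h2 : Function.Injective (derAt F x) :=
    (injective_iff_map_eq_zero _).2 fun D hD => h D (by
      change derAt F x D ∈ V
      rw [hD]; exact V.zero_mem)
  have h3 := Submodule.finrank_sup_add_finrank_inf_eq V (LinearMap.range (derAt F x))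
  rwa [h1, finrank_bot, add_zero, LinearMap.finrank_range_of_inj h2] at h3

/-- This upper bound, available because one vector generates, forces equality in the dimension
counts below. -/
theorem IsDerivedSpace.finrank_le [FiniteDimensional K (Derivation F K K)]
    (h : IsDerivedSpace F U U') :
    Module.finrank K U' ≤ Module.finrank K U + Module.finrank K (Derivation F K K) := by
  obtain ⟨u, _, hgen⟩ := h.exists_gen
  calc Module.finrank K U' ≤ Module.finrank K ↥(U ⊔ LinearMap.range (derAt F u)) :=
        Submodule.finrank_mono hgen
    _ ≤ Module.finrank K U + Module.finrank K (LinearMap.range (derAt F u)) :=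
        Submodule.finrank_add_le_finrank_add_finrank _ _
    _ ≤ _ := Nat.add_le_add_left (LinearMap.finrank_range_le _) _

theorem IsDerivedSpace.perp [FiniteDimensional K (Derivation F K K)] (h : IsDerivedSpace F U U')
    (hη : η ∈ perp U') (hx : x ∈ U) (hnd : HasNondegeneratePairing F η x) :
    IsDerivedSpace F (perp U') (perp U) := by
  refine ⟨perp_antitone h.le, fun ξ hξ D => h.derVec_mem_perp hξ D, η, hη, ?_⟩
  -- Here the symmetry of the pairing enters: `D₀ η ⟂ U'` gives `η·D₀(D x) = 0`, and exchanging `D₀`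
  -- and `D` puts `D₀` in the slot where nondegeneracy applies.
  have hinj : ∀ D₀ : Derivation F K K, derVec D₀ η ∈ Scroll.perp U' → D₀ = 0 := by
    refine fun D₀ hD₀ => hnd D₀ fun D => ?_
    have hm : derVec D x ∈ U' := h.derVec_mem x hx D
    have h2 := derivation_dotProduct D₀ η (derVec D x)
    rw [hη _ hm, map_zero, hD₀ _ hm, zero_add] at h2
    rw [derVec_commutator, dotProduct_add, ← h2, hη _ (h.derVec_mem x hx _), add_zero]
  have hle : Scroll.perp U' ⊔ LinearMap.range (derAt F η) ≤ Scroll.perp U := by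
    refine sup_le (perp_antitone h.le) ?_
    rintro _ ⟨D, rfl⟩
    exact h.derVec_mem_perp hη D
  refine (Submodule.eq_of_le_of_finrank_le hle ?_).ge
  rw [finrank_sup_range_derAt hinj]
  have h1 := finrank_add_finrank_perp U
  have h2 := finrank_add_finrank_perp U'
  have h3 := h.finrank_le
  omega

/-- As `U'` is a hyperplane, `perp U'` is the line of `η`, and `himm` makes `D ↦ D η` injective
modulo it. By dimensions `perp U = perp U' + Der η`. If `η·D(E u) = 0` for all `D`, then `E u` is
orthogonal to every `D η`, hence lies in `U`; the same count shows that this forces `E = 0` for the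
generator `u`. -/
theorem IsDerivedSpace.exists_nondegeneratePairing [FiniteDimensional K (Derivation F K K)]
    (h : IsDerivedSpace F U U') (hcard : Module.finrank K U' + 1 = Fintype.card n)
    (hη : η ∈ Scroll.perp U') (hη0 : η ≠ 0)
    (himm : ∀ D : Derivation F K K, derVec D η ∈ Submodule.span K {η} → D = 0) :
    ∃ u ∈ U, HasNondegeneratePairing F η u := by
  have hspan : Submodule.span K {η} = Scroll.perp U' := by
    refine Submodule.eq_of_le_of_finrank_le ((Submodule.span_singleton_le_iff_mem _ _).2 hη) ?_
    rw [finrank_span_singleton hη0]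
    have := finrank_add_finrank_perp U'
    omega
  rw [hspan] at himm
  have hle : Scroll.perp U' ⊔ LinearMap.range (derAt F η) ≤ Scroll.perp U := by
    refine sup_le (perp_antitone h.le) ?_
    rintro _ ⟨D, rfl⟩
    exact h.derVec_mem_perp hη D
  have h1 := finrank_add_finrank_perp U
  have h2 := finrank_add_finrank_perp U'
  have h3 := h.finrank_le
  have heq := Submodule.eq_of_le_of_finrank_le hle (by
    rw [finrank_sup_range_derAt himm]; omega)
  have h4 := Submodule.finrank_mono hle
  rw [finrank_sup_range_derAt himm] at h4
  obtain ⟨u, hu, hgen⟩ := h.exists_gen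
  have hmem : ∀ E : Derivation F K K,
      (∀ D : Derivation F K K, η ⬝ᵥ derVec D (derVec E u) = 0) → derVec E u ∈ U := by
    intro E hE
    rw [← perp_perp U, ← heq]
    have hm := h.derVec_mem u hu E
    intro y hy
    obtain ⟨a, ha, _, ⟨D, rfl⟩, rfl⟩ := Submodule.mem_sup.1 hy
    have h5 := derivation_dotProduct D η (derVec E u)
    rw [hη _ hm, map_zero, hE D, add_zero] at h5
    rw [dotProduct_comm, add_dotProduct, ha _ hm, zero_add]
    exact h5.symm
  have h5 := Submodule.finrank_mono hgen
  have h6 := Submodule.finrank_sup_add_finrank_inf_eq U (LinearMap.range (derAt F u))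
  have h7 := LinearMap.finrank_range_add_finrank_ker (derAt F u)
  -- Now `dim U' = dim U + dim Der`, while `u` generates `U'` over `U`, so `D ↦ D u` must be
  -- injective modulo `U`.
  have h8 : U ⊓ LinearMap.range (derAt F u) = ⊥ := Submodule.finrank_eq_zero.1 (by omega)
  have h9 : LinearMap.ker (derAt F u) = ⊥ := Submodule.finrank_eq_zero.1 (by omega)
  refine ⟨u, hu, fun E hE => ?_⟩
  have h10 : derAt F u E ∈ U ⊓ LinearMap.range (derAt F u) := ⟨hmem E hE, E, rfl⟩
  rw [h8] at h10
  exact LinearMap.ker_eq_bot'.1 h9 E h10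

end Derivations

/-! ### Linear independence witnessed by dual families. -/

section Independence

/-- A dual family turns independence into algebraic identities, which survive specialisation and
extension of fields. -/
theorem LinearIndependent.exists_dotProduct {k : Type*} [Field k] {ι n : Type*} [Fintype n]
    [DecidableEq ι] {v : ι → n → k} (h : LinearIndependent k v) :
    ∃ w : ι → n → k, ∀ i j, w i ⬝ᵥ v j = if i = j then 1 else 0 := by
  classical
  have h2 : ∀ i, ∃ w : n → k, ∀ j, w ⬝ᵥ v j = if i = j then 1 else 0 := by
    intro i
    obtain ⟨g, hg⟩ := LinearMap.exists_leftInverse_of_injective (Finsupp.linearCombination k v)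
      (LinearMap.ker_eq_bot.2 h)
    let f : Module.Dual k (n → k) := (Finsupp.lapply i) ∘ₗ g
    refine ⟨(dotProductEquiv k n).symm f, fun j => ?_⟩
    have h3 : (dotProductEquiv k n ((dotProductEquiv k n).symm f)) (v j) = f (v j) := by
      rw [LinearEquiv.apply_symm_apply]
    have h4 : g (v j) = Finsupp.single j 1 := by
      have := LinearMap.congr_fun hg (Finsupp.single j 1)
      simpa using this
    rw [dotProductEquiv_apply_apply] at h3
    rw [h3]
    simp [f, h4, Finsupp.single_apply, eq_comm]
  exact Classical.skolem.1 h2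

theorem linearIndependent_of_dotProduct {k : Type*} [Field k] {ι n : Type*} [Fintype n]
    [Finite ι] [DecidableEq ι] {v w : ι → n → k} {c : k} (hc : c ≠ 0)
    (h : ∀ i j, w i ⬝ᵥ v j = if i = j then c else 0) : LinearIndependent k v := by
  cases nonempty_fintype ι
  refine Fintype.linearIndependent_iff.2 fun g hg i => ?_
  have h1 : w i ⬝ᵥ ∑ j, g j • v j = 0 := by rw [hg, dotProduct_zero]
  simp only [dotProduct_sum, dotProduct_smul, h, smul_eq_mul, mul_ite, mul_zero,
    Finset.sum_ite_eq, Finset.mem_univ, if_true] at h1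
  exact (mul_eq_zero.1 h1).resolve_right hc

/-- Linear independence of the images of vectors over a `k`-algebra under a `k`-point is
witnessed by the nonvanishing of one element. -/
theorem exists_ne_zero_forall_linearIndependent {k R : Type*} [Field k] [CommRing R] [Algebra k R]
    {ι n : Type*} [Finite ι] [Fintype n] (φ : R →ₐ[k] k) {s : ι → n → R}
    (h : LinearIndependent k fun j i => φ (s j i)) :
    ∃ r : R, φ r ≠ 0 ∧ ∀ (L : Type) [Field L] (ψ : R →+* L), ψ r ≠ 0 →
      LinearIndependent L fun j i => ψ (s j i) := by
  classical
  cases nonempty_fintype ι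
  obtain ⟨w, hw⟩ := LinearIndependent.exists_dotProduct h
  -- Under `φ` this matrix of pairings becomes the identity, so its determinant is the required
  -- element.
  let M : Matrix ι ι R := fun i j => ∑ l, algebraMap k R (w i l) * s j l
  refine ⟨M.det, ?_, fun L _ ψ hψ => ?_⟩
  · have h1 : φ.toRingHom.mapMatrix M = 1 := by
      ext i j
      have h0 : φ.toRingHom.mapMatrix M i j = ∑ l, w i l * φ (s j l) := by
        change φ (∑ l, algebraMap k R (w i l) * s j l) = _
        simp
      rw [h0, Matrix.one_apply]
      exact hw i j
    have h2 := RingHom.map_det φ.toRingHom M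
    rw [h1, Matrix.det_one] at h2
    change φ M.det = 1 at h2
    rw [h2]
    exact one_ne_zero
  · rw [RingHom.map_det] at hψ
    refine Fintype.linearIndependent_iff.2 fun g hg => ?_
    have h1 : (ψ.mapMatrix M).mulVec g = 0 := by
      ext i
      have h2 : ∀ l, ∑ j, g j * ψ (s j l) = 0 := fun l => by
        simpa using congrFun hg l
      calc (ψ.mapMatrix M).mulVec g i
          = ∑ j, ∑ l, ψ (algebraMap k R (w i l)) * (g j * ψ (s j l)) := by
            refine Finset.sum_congr rfl fun j _ => ?_
            change ψ (∑ l, algebraMap k R (w i l) * s j l) * g j = _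
            rw [map_sum, Finset.sum_mul]
            exact Finset.sum_congr rfl fun l _ => by rw [map_mul]; ring
        _ = ∑ l, ψ (algebraMap k R (w i l)) * ∑ j, g j * ψ (s j l) := by
            rw [Finset.sum_comm]
            exact Finset.sum_congr rfl fun l _ => by rw [Finset.mul_sum]
        _ = 0 := by simp [h2]
    exact fun i => congrFun (Matrix.eq_zero_of_mulVec_eq_zero hψ h1) i

end Independence

/-! ### General points of the base. -/

section Generally

variable {m : ℕ} {I : Ideal (MvPolynomial (Fin m) ℂ)}

theorem Generally.mono {P Q : (Fin m → ℂ) → Prop} (hP : Generally I P)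
    (h : ∀ b ∈ zeroLocus ℂ I, P b → Q b) : Generally I Q := by
  obtain ⟨p, hp, hP⟩ := hP
  exact ⟨p, hp, fun b hb hpb => h b hb (hP b hb hpb)⟩

theorem Generally.and {P Q : (Fin m → ℂ) → Prop} (hI : I.IsPrime) (hP : Generally I P)
    (hQ : Generally I Q) : Generally I fun b => P b ∧ Q b := by
  obtain ⟨p, hp, hP⟩ := hP
  obtain ⟨q, hq, hQ⟩ := hQ
  refine ⟨p * q, fun h => (hI.mem_or_mem h).elim hp hq, fun b hb hpq => ?_⟩
  rw [map_mul] at hpq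
  exact ⟨hP b hb (left_ne_zero_of_mul hpq), hQ b hb (right_ne_zero_of_mul hpq)⟩

theorem Generally.forall {ι : Type*} [Finite ι] {P : ι → (Fin m → ℂ) → Prop} (hI : I.IsPrime)
    (h : ∀ i, Generally I (P i)) : Generally I fun b => ∀ i, P i b := by
  cases nonempty_fintype ι
  choose p hp hP using h
  refine ⟨∏ i, p i, fun hmem => ?_, fun b hb hpb i => hP i b hb ?_⟩
  · obtain ⟨i, _, hi⟩ := (hI.prod_mem_iff).1 hmem
    exact hp i hi
  · rw [map_prod] at hpb
    exact Finset.prod_ne_zero_iff.1 hpb i (Finset.mem_univ i)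

theorem mem_of_forall_zeroLocus (hI : I.IsPrime) {p : MvPolynomial (Fin m) ℂ}
    (h : ∀ b ∈ zeroLocus ℂ I, aeval b p = 0) : p ∈ I := by
  rw [← MvPolynomial.IsPrime.vanishingIdeal_zeroLocus (K := ℂ) I]
  exact h

theorem Generally.exists {P : (Fin m → ℂ) → Prop} (hI : I.IsPrime) (h : Generally I P) :
    ∃ b ∈ zeroLocus ℂ I, P b := by
  obtain ⟨p, hp, hP⟩ := h
  by_contra! hcon
  refine hp (mem_of_forall_zeroLocus hI fun b hb => ?_)
  by_contra hpb
  exact hcon b hb (hP b hb hpb)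

theorem generally_ne_zero {p : MvPolynomial (Fin m) ℂ} (hp : p ∉ I) :
    Generally I fun b => aeval b p ≠ 0 := ⟨p, hp, fun _ _ h => h⟩

end Generally

/-! ### The function field, and linear algebra at the generic versus a general point. -/

section FunctionField

variable {m : ℕ} (I : Ideal (MvPolynomial (Fin m) ℂ)) [hI : I.IsPrime]

/-- The field of rational functions on the variety `V(I)`. -/
abbrev FunctionField : Type := FractionRing (MvPolynomial (Fin m) ℂ ⧸ I)

/-- The rational function given by a polynomial. -/
def toFF : MvPolynomial (Fin m) ℂ →ₐ[ℂ] FunctionField I :=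
  (IsScalarTower.toAlgHom ℂ (MvPolynomial (Fin m) ℂ ⧸ I) (FunctionField I)).comp
    (Ideal.Quotient.mkₐ ℂ I)

variable {I}

theorem toFF_eq_zero {p : MvPolynomial (Fin m) ℂ} : toFF I p = 0 ↔ p ∈ I := by
  rw [← Ideal.Quotient.eq_zero_iff_mem]
  exact map_eq_zero_iff (algebraMap (MvPolynomial (Fin m) ℂ ⧸ I) (FunctionField I))
    (IsFractionRing.injective _ _)

theorem aeval_eq_of_toFF_eq {p q : MvPolynomial (Fin m) ℂ} (h : toFF I p = toFF I q)
    {b : Fin m → ℂ} (hb : b ∈ zeroLocus ℂ I) : aeval b p = aeval b q := by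
  rw [← sub_eq_zero, ← map_sub, toFF_eq_zero] at h
  have := hb _ h
  rwa [map_sub, sub_eq_zero] at this

theorem exists_common_denominator {ι : Type*} [Finite ι] (x : ι → FunctionField I) :
    ∃ q : MvPolynomial (Fin m) ℂ, q ∉ I ∧ ∃ p : ι → MvPolynomial (Fin m) ℂ,
      ∀ i, toFF I (p i) = toFF I q * x i := by
  obtain ⟨b, hb⟩ := IsLocalization.exist_integer_multiples_of_finite
    (nonZeroDivisors (MvPolynomial (Fin m) ℂ ⧸ I)) x
  obtain ⟨q, hq⟩ := Ideal.Quotient.mk_surjective (b : MvPolynomial (Fin m) ℂ ⧸ I)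
  choose a ha using hb
  choose p hp using fun i => Ideal.Quotient.mk_surjective (a i)
  refine ⟨q, fun hqI => ?_, p, fun i => ?_⟩
  · exact nonZeroDivisors.coe_ne_zero b (hq ▸ Ideal.Quotient.eq_zero_iff_mem.2 hqI)
  · change algebraMap _ (FunctionField I) (Ideal.Quotient.mk I (p i)) =
      algebraMap _ (FunctionField I) (Ideal.Quotient.mk I q) * x i
    rw [hp, hq, ha, Algebra.smul_def]

variable {n : Type*} [Fintype n] {ι : Type*} [Finite ι]

variable (I) in
/-- The span over the function field of polynomial vectors. -/
def spanFF {ι n : Type*} (s : ι → n → MvPolynomial (Fin m) ℂ) :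
    Submodule (FunctionField I) (n → FunctionField I) :=
  Submodule.span _ (Set.range fun j i => toFF I (s j i))

/-- The span of the values of polynomial vectors at `b`. -/
def spanEval {ι n : Type*} (s : ι → n → MvPolynomial (Fin m) ℂ) (b : Fin m → ℂ) :
    Submodule ℂ (n → ℂ) :=
  Submodule.span ℂ (Set.range fun j i => aeval b (s j i))

/-- A linear relation over the function field specialises wherever a common denominator of its
coefficients is nonzero. -/
theorem generally_mem_spanEval {s : ι → n → MvPolynomial (Fin m) ℂ}
    {t : n → MvPolynomial (Fin m) ℂ} (h : (fun i => toFF I (t i)) ∈ spanFF I s) :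
    Generally I fun b => (fun i => aeval b (t i)) ∈ spanEval s b := by
  cases nonempty_fintype ι
  obtain ⟨c, hc⟩ := (Submodule.mem_span_range_iff_exists_fun _).1 h
  obtain ⟨q, hq, p, hp⟩ := exists_common_denominator c
  refine ⟨q, hq, fun b hb hqb => ?_⟩
  have h1 : ∀ i, aeval b (q * t i) = aeval b (∑ j, p j * s j i) := fun i => by
    refine aeval_eq_of_toFF_eq (I := I) ?_ hb
    have h2 := congrFun hc i
    simp only [Finset.sum_apply, Pi.smul_apply, smul_eq_mul] at h2
    rw [map_mul, ← h2, map_sum, Finset.mul_sum]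
    exact Finset.sum_congr rfl fun j _ => by rw [map_mul, hp, mul_assoc]
  refine (Submodule.mem_span_range_iff_exists_fun _).2 ⟨fun j => (aeval b q)⁻¹ * aeval b (p j), ?_⟩
  funext i
  have h3 := h1 i
  simp only [map_mul, map_sum] at h3
  simp only [Finset.sum_apply, Pi.smul_apply, smul_eq_mul, mul_assoc, ← Finset.mul_sum]
  rw [← h3, inv_mul_cancel_left₀ hqb]

/-- Otherwise a functional `ξ` kills all `s j` but not `t`. With denominators cleared it kills every
`s j` modulo `I`, while its value on `t` is nonzero at a general point, against membership there. -/
theorem mem_spanFF_of_generally {s : ι → n → MvPolynomial (Fin m) ℂ}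
    {t : n → MvPolynomial (Fin m) ℂ}
    (h : Generally I fun b => (fun i => aeval b (t i)) ∈ spanEval s b) :
    (fun i => toFF I (t i)) ∈ spanFF I s := by
  by_contra hcon
  have h1 : ¬ ∀ ξ ∈ perp (spanFF I s), (fun i => toFF I (t i)) ⬝ᵥ ξ = 0 := by
    rw [← perp_perp (spanFF I s)] at hcon
    exact hcon
  push Not at h1
  obtain ⟨ξ, hξ, hne⟩ := h1
  obtain ⟨q, hq, p, hp⟩ := exists_common_denominator ξ
  have hq0 : toFF I q ≠ 0 := fun h => hq (toFF_eq_zero.1 h)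
  have hpair : ∀ u : n → MvPolynomial (Fin m) ℂ,
      toFF I (∑ i, p i * u i) = toFF I q * (ξ ⬝ᵥ fun i => toFF I (u i)) := fun u => by
    simp only [map_sum, map_mul, hp, dotProduct, Finset.mul_sum, mul_assoc]
  have hpt : ∑ i, p i * t i ∉ I := fun hmem => by
    rw [← toFF_eq_zero, hpair, dotProduct_comm] at hmem
    exact (mul_ne_zero hq0 hne) hmem
  obtain ⟨b, hb, hmem, hbt⟩ := (h.and hI (generally_ne_zero hpt)).exists hI
  have h2 : spanEval s b ≤ perp (Submodule.span ℂ {fun i => aeval b (p i)}) := by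
    refine Submodule.span_le.2 ?_
    rintro _ ⟨j, rfl⟩ x hx
    obtain ⟨c, rfl⟩ := Submodule.mem_span_singleton.1 hx
    have h3 : ∑ i, p i * s j i ∈ I := by
      rw [← toFF_eq_zero, hpair, hξ _ (Submodule.subset_span ⟨j, rfl⟩), mul_zero]
    have h4 := hb _ h3
    simp only [map_sum, map_mul] at h4
    rw [dotProduct_smul, dotProduct_comm]
    simp only [dotProduct]
    rw [h4, smul_zero]
  have h5 := h2 hmem _ (Submodule.mem_span_singleton_self _)
  rw [dotProduct_comm] at h5
  simp only [map_sum, map_mul] at hbt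
  exact hbt h5

theorem generally_linearIndependent {s : ι → n → MvPolynomial (Fin m) ℂ}
    (h : LinearIndependent (FunctionField I) fun j i => toFF I (s j i)) :
    Generally I fun b => LinearIndependent ℂ fun j i => aeval b (s j i) := by
  classical
  obtain ⟨w, hw⟩ := LinearIndependent.exists_dotProduct h
  obtain ⟨q, hq, p, hp⟩ := exists_common_denominator fun x : ι × n => w x.1 x.2
  refine ⟨q, hq, fun b hb hqb => linearIndependent_of_dotProduct
    (w := fun j i => aeval b (p (j, i))) hqb fun i j => ?_⟩
  have h1 : aeval b (∑ l, p (i, l) * s j l) = aeval b (if i = j then q else 0) := by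
    refine aeval_eq_of_toFF_eq (I := I) ?_ hb
    have h2 := hw i j
    simp only [dotProduct] at h2
    simp only [map_sum, map_mul, hp, mul_assoc, ← Finset.mul_sum, h2]
    split_ifs <;> simp
  simp only [map_sum, map_mul] at h1
  simp only [dotProduct, h1]
  split_ifs <;> simp

/-- The determinant witnessing independence at `b` is not in `I`, since elements of `I` vanish at
`b`. Hence rank can only drop under specialisation. -/
theorem linearIndependent_toFF {s : ι → n → MvPolynomial (Fin m) ℂ} {b : Fin m → ℂ}
    (hb : b ∈ zeroLocus ℂ I) (h : LinearIndependent ℂ fun j i => aeval b (s j i)) :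
    LinearIndependent (FunctionField I) fun j i => toFF I (s j i) := by
  obtain ⟨r, hr, hL⟩ := exists_ne_zero_forall_linearIndependent (aeval b) h
  exact hL _ (toFF I).toRingHom fun h0 => hr (hb _ (toFF_eq_zero.1 h0))

theorem exists_subfamily_basis {k : Type*} [Field k] {ι V : Type*} [Finite ι] [AddCommGroup V]
    [Module k V] (v : ι → V) :
    ∃ e : Fin (Module.finrank k (Submodule.span k (Set.range v))) → ι,
      LinearIndependent k (v ∘ e) := by
  have := Module.Finite.span_of_finite k (Set.finite_range v)
  obtain ⟨f, hf, -, hli⟩ := Submodule.exists_fun_fin_finrank_span_eq k (Set.range v)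
  choose e he using hf
  exact ⟨e, by rwa [show v ∘ e = f from funext he]⟩

theorem card_le_finrank_span_of_comp {k : Type*} [Field k] {ι V : Type*} [Finite ι]
    [AddCommGroup V] [Module k V] {v : ι → V} {r : ℕ} {e : Fin r → ι}
    (h : LinearIndependent k (v ∘ e)) :
    r ≤ Module.finrank k (Submodule.span k (Set.range v)) := by
  have h1 := finrank_span_eq_card h
  rw [Fintype.card_fin] at h1
  rw [← h1]
  have := Module.Finite.span_of_finite k (Set.finite_range v)
  exact Submodule.finrank_mono (Submodule.span_mono (Set.range_comp_subset_range e v))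

theorem generally_finrank_le (s : ι → n → MvPolynomial (Fin m) ℂ) :
    Generally I fun b => Module.finrank (FunctionField I) (spanFF I s) ≤
      Module.finrank ℂ (spanEval s b) := by
  obtain ⟨e, he⟩ := exists_subfamily_basis (k := FunctionField I) fun j i => toFF I (s j i)
  exact (generally_linearIndependent (s := s ∘ e) he).mono fun b _ h =>
    card_le_finrank_span_of_comp (e := e) h

theorem finrank_spanEval_le (s : ι → n → MvPolynomial (Fin m) ℂ) {b : Fin m → ℂ}
    (hb : b ∈ zeroLocus ℂ I) :
    Module.finrank ℂ (spanEval s b) ≤ Module.finrank (FunctionField I) (spanFF I s) := by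
  obtain ⟨e, he⟩ := exists_subfamily_basis (k := ℂ) fun j i => aeval b (s j i)
  exact card_le_finrank_span_of_comp (e := e) (linearIndependent_toFF (s := s ∘ e) hb he)

theorem generally_finrank_eq (s : ι → n → MvPolynomial (Fin m) ℂ) :
    Generally I fun b => Module.finrank ℂ (spanEval s b) =
      Module.finrank (FunctionField I) (spanFF I s) :=
  (generally_finrank_le s).mono fun _ hb h => le_antisymm (finrank_spanEval_le s hb) h

/-- Orthogonality of `s` and `f` is an identity modulo `I`, valid at every point of the variety;
constancy of both ranks at general points makes the inclusion an equality. -/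
theorem generally_perp_eq {κ : Type*} [Finite κ] {f : κ → n → MvPolynomial (Fin m) ℂ}
    {s : ι → n → MvPolynomial (Fin m) ℂ} (h : perp (spanFF I f) = spanFF I s) :
    Generally I fun b => perp (spanEval f b) = spanEval s b := by
  refine ((generally_finrank_eq f).and hI (generally_finrank_eq s)).mono fun b hb hfs => ?_
  refine (Submodule.eq_of_le_of_finrank_eq ?_ ?_).symm
  · refine Submodule.span_le.2 ?_
    rintro _ ⟨j, rfl⟩ x hx
    have h2 : spanEval f b ≤ perp (Submodule.span ℂ {fun i => aeval b (s j i)}) := by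
      refine Submodule.span_le.2 ?_
      rintro _ ⟨l, rfl⟩ y hy
      obtain ⟨c, rfl⟩ := Submodule.mem_span_singleton.1 hy
      have h3 : ∑ i, s j i * f l i ∈ I := by
        have h4 : (fun i => toFF I (s j i)) ∈ perp (spanFF I f) :=
          h ▸ Submodule.subset_span ⟨j, rfl⟩
        have h5 := h4 _ (Submodule.subset_span ⟨l, rfl⟩)
        rw [← toFF_eq_zero]
        simpa only [dotProduct, map_sum, map_mul] using h5
      have h4 := hb _ h3
      simp only [map_sum, map_mul] at h4
      rw [dotProduct_smul, dotProduct_comm]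
      simp only [dotProduct]
      rw [h4, smul_zero]
    rw [dotProduct_comm]
    exact h2 hx _ (Submodule.mem_span_singleton_self _)
  · have h6 := finrank_add_finrank_perp (spanEval f b)
    have h7 := finrank_add_finrank_perp (spanFF I f)
    rw [h] at h7
    omega

theorem exists_polynomial_frame (U : Submodule (FunctionField I) (n → FunctionField I)) :
    ∃ s : Fin (Module.finrank (FunctionField I) U) → n → MvPolynomial (Fin m) ℂ,
      (LinearIndependent (FunctionField I) fun j i => toFF I (s j i)) ∧ spanFF I s = U := by
  let v := Module.finBasis (FunctionField I) U
  obtain ⟨q, hq, p, hp⟩ := exists_common_denominator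
    fun x : Fin (Module.finrank (FunctionField I) U) × n => (v x.1 : n → FunctionField I) x.2
  have hq0 : toFF I q ≠ 0 := fun h => hq (toFF_eq_zero.1 h)
  have h1 : (fun j i => toFF I (p (j, i))) =
      fun j => toFF I q • (v j : n → FunctionField I) := by
    funext j i
    exact hp (j, i)
  have hli : LinearIndependent (FunctionField I) fun j => (v j : n → FunctionField I) :=
    v.linearIndependent.map' U.subtype U.ker_subtype
  have hli2 : LinearIndependent (FunctionField I) fun j i => toFF I (p (j, i)) := by
    rw [h1]
    exact hli.units_smul fun _ => Units.mk0 _ hq0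
  refine ⟨fun j i => p (j, i), hli2, Submodule.eq_of_le_of_finrank_eq ?_ ?_⟩
  · refine Submodule.span_le.2 ?_
    rintro _ ⟨j, rfl⟩
    change (fun j i => toFF I (p (j, i))) j ∈ U
    rw [h1]
    exact U.smul_mem _ (v j).2
  · exact (finrank_span_eq_card hli2).trans (Fintype.card_fin _)

end FunctionField

/-! ### Extension of derivations and the chain rule. -/

section Extension

/-- Derivations extend along formally étale maps. -/
theorem exists_derivation_extension {R S T : Type*} [CommRing R] [CommRing S] [CommRing T]
    [Algebra R S] [Algebra R T] [Algebra S T] [IsScalarTower R S T] [Algebra.FormallyEtale S T]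
    (d : Derivation R S T) : ∃ D : Derivation R T T, ∀ s, D (algebraMap S T s) = d s := by
  have h := KaehlerDifferential.isBaseChange_of_formallyEtale R S T
  refine ⟨(h.lift d.liftKaehlerDifferential).compDer (KaehlerDifferential.D R T), fun s => ?_⟩
  have h1 := h.lift_eq d.liftKaehlerDifferential (KaehlerDifferential.D R S s)
  rw [KaehlerDifferential.map_D, Derivation.liftKaehlerDifferential_comp_D] at h1
  exact h1

theorem derivation_aeval {R B M σ : Type*} [CommRing R] [CommRing B] [Algebra R B]
    [AddCommGroup M] [Module R M] [Module B M] [IsScalarTower R B M] [Fintype σ]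
    (D : Derivation R B M) (f : σ → B) (p : MvPolynomial σ R) :
    D (aeval f p) = ∑ l, aeval f (pderiv l p) • D (f l) := by
  classical
  induction p using MvPolynomial.induction_on with
  | C a => simp
  | add p q hp hq => simp [hp, hq, add_smul, Finset.sum_add_distrib]
  | mul_X p i hp =>
    have h : ∀ l, aeval f (pderiv l (p * X i)) • D (f l) =
        (if l = i then aeval f p • D (f l) else 0) + f i • aeval f (pderiv l p) • D (f l) := by
      intro l
      rw [(pderiv l).leibniz, pderiv_X, map_add, add_smul, smul_eq_mul, smul_eq_mul, map_mul,
        map_mul, aeval_X, mul_smul (f i)]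
      congr 1
      split_ifs with hl
      · subst hl
        simp
      · simp [Ne.symm hl]
    rw [map_mul, aeval_X, D.leibniz, hp, Finset.sum_congr rfl fun l _ => h l,
      Finset.sum_add_distrib, Finset.sum_ite_eq' Finset.univ i, if_pos (Finset.mem_univ i),
      Finset.smul_sum]

end Extension

/-! ### Derivations of the function field as generic tangent vectors. -/

section Tangent

variable {m : ℕ} {I : Ideal (MvPolynomial (Fin m) ℂ)} [hI : I.IsPrime]

theorem toFF_eq_aeval (p : MvPolynomial (Fin m) ℂ) :
    toFF I p = aeval (fun l => toFF I (X l)) p := by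
  rw [← comp_aeval_apply, aeval_X_left_apply]

theorem derivation_toFF (D : Derivation ℂ (FunctionField I) (FunctionField I))
    (p : MvPolynomial (Fin m) ℂ) :
    D (toFF I p) = ∑ l, toFF I (pderiv l p) * D (toFF I (X l)) := by
  rw [toFF_eq_aeval p, derivation_aeval]
  exact Finset.sum_congr rfl fun l _ => by rw [toFF_eq_aeval (pderiv l p), smul_eq_mul]

theorem derivation_eq_zero_of_toFF_X {D : Derivation ℂ (FunctionField I) (FunctionField I)}
    (h : ∀ l, D (toFF I (X l)) = 0) : D = 0 := by
  have h0 : ∀ p, D (toFF I p) = 0 := fun p => by simp [derivation_toFF, h]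
  ext x
  obtain ⟨q, hq, p, hp⟩ := exists_common_denominator fun _ : Unit => x
  have h1 := congrArg D (hp ())
  rw [h0, D.leibniz, h0, smul_zero, add_zero, smul_eq_mul] at h1
  have hq0 : toFF I q ≠ 0 := fun h => hq (toFF_eq_zero.1 h)
  exact (mul_eq_zero.1 h1.symm).resolve_left hq0

/-- The hypothesis says that the derivation of the polynomial ring with values `v` kills `I`. It
therefore descends to the coordinate ring, and extends to the fraction field because localisation is
formally étale. -/
theorem exists_derivation_of_forall_mem (v : Fin m → FunctionField I)
    (hv : ∀ p ∈ I, ∑ l, toFF I (pderiv l p) * v l = 0) :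
    ∃ D : Derivation ℂ (FunctionField I) (FunctionField I), ∀ l, D (toFF I (X l)) = v l := by
  let d : Derivation ℂ (MvPolynomial (Fin m) ℂ) (FunctionField I) := mkDerivation ℂ v
  have hd : ∀ p, d p = ∑ l, toFF I (pderiv l p) * v l := fun p => by
    have h := derivation_aeval d (X : Fin m → MvPolynomial (Fin m) ℂ) p
    simp only [aeval_X_left_apply] at h
    rw [h]
    refine Finset.sum_congr rfl fun l _ => ?_
    rw [show d (X l) = v l from mkDerivation_X ℂ v l]
    exact Algebra.smul_def _ _
  let φ : (MvPolynomial (Fin m) ℂ ⧸ I) →ₗ[ℂ] FunctionField I :=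
    (Submodule.liftQ (I.restrictScalars ℂ) d.toLinearMap
      (fun p hp => (hd p).trans (hv p hp))) ∘ₗ
      (Submodule.Quotient.restrictScalarsEquiv ℂ I).symm.toLinearMap
  have hφ : ∀ p, φ (Ideal.Quotient.mk I p) = d p := fun p => rfl
  let d' : Derivation ℂ (MvPolynomial (Fin m) ℂ ⧸ I) (FunctionField I) :=
    Derivation.mk' φ fun a b => by
      obtain ⟨p, rfl⟩ := Ideal.Quotient.mk_surjective a
      obtain ⟨q, rfl⟩ := Ideal.Quotient.mk_surjective b
      rw [← map_mul, hφ, hφ, hφ, d.leibniz]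
      have h : ∀ (r : MvPolynomial (Fin m) ℂ) (x : FunctionField I),
          r • x = Ideal.Quotient.mk I r • x := fun r x =>
        (Algebra.smul_def r x).trans (Algebra.smul_def (Ideal.Quotient.mk I r) x).symm
      exact congrArg₂ (· + ·) (h p (d q)) (h q (d p))
  have : Algebra.FormallyEtale (MvPolynomial (Fin m) ℂ ⧸ I) (FunctionField I) :=
    Algebra.FormallyEtale.of_isLocalization (nonZeroDivisors (MvPolynomial (Fin m) ℂ ⧸ I))
  obtain ⟨D, hD⟩ := exists_derivation_extension d'
  refine ⟨D, fun l => (hD (Ideal.Quotient.mk I (X l))).trans ?_⟩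
  change d (X l) = v l
  exact mkDerivation_X ℂ v l

variable (I) in
/-- The coordinates of a derivation. -/
def derivationCoord : Derivation ℂ (FunctionField I) (FunctionField I) →ₗ[FunctionField I]
    (Fin m → FunctionField I) where
  toFun := fun D l => D (toFF I (X l))
  map_add' := fun _ _ => rfl
  map_smul' := fun _ _ => rfl

theorem derivationCoord_injective : Function.Injective (derivationCoord I) :=
  (injective_iff_map_eq_zero _).2 fun _ hD => derivation_eq_zero_of_toFF_X fun l => congrFun hD l

instance : FiniteDimensional (FunctionField I)
    (Derivation ℂ (FunctionField I) (FunctionField I)) :=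
  FiniteDimensional.of_injective _ derivationCoord_injective

theorem dirDeriv_mul (b v : Fin m → ℂ) (p q : MvPolynomial (Fin m) ℂ) :
    dirDeriv b v (p * q) = aeval b p * dirDeriv b v q + aeval b q * dirDeriv b v p := by
  simp only [dirDeriv, (pderiv _).leibniz, map_add, smul_eq_mul, map_mul, mul_add,
    Finset.sum_add_distrib, Finset.mul_sum]
  congr 1 <;> exact Finset.sum_congr rfl fun l _ => by ring

theorem dirDeriv_add (b v : Fin m → ℂ) (p q : MvPolynomial (Fin m) ℂ) :
    dirDeriv b v (p + q) = dirDeriv b v p + dirDeriv b v q := by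
  simp only [dirDeriv, map_add, mul_add, Finset.sum_add_distrib]

theorem tangentSpace_eq_perp {S : Set (MvPolynomial (Fin m) ℂ)} (hS : Ideal.span S = I)
    {b : Fin m → ℂ} (hb : b ∈ zeroLocus ℂ I) :
    tangentSpace I b = perp (spanEval (fun (p : S) l => pderiv l p.1) b) := by
  refine le_antisymm (fun v hv => ?_) fun v hv => ?_
  · have h : spanEval (fun (p : S) l => pderiv l p.1) b ≤ perp (Submodule.span ℂ {v}) := by
      refine Submodule.span_le.2 ?_
      rintro _ ⟨p, rfl⟩ x hx
      obtain ⟨c, rfl⟩ := Submodule.mem_span_singleton.1 hx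
      have h1 := hv p.1 (hS ▸ Ideal.subset_span p.2)
      rw [dotProduct_smul, dotProduct_comm]
      simp only [dotProduct]
      rw [show ∑ i, v i * aeval b (pderiv i p.1) = 0 from h1, smul_zero]
    intro x hx
    rw [dotProduct_comm]
    exact h hx _ (Submodule.mem_span_singleton_self _)
  · intro p hp
    rw [← hS] at hp
    induction hp using Submodule.span_induction with
    | mem p hp => exact hv _ (Submodule.subset_span ⟨⟨p, hp⟩, rfl⟩)
    | zero => simp [dirDeriv]
    | add p q _ _ hp hq => rw [dirDeriv_add, hp, hq, add_zero]
    | smul a p hpS hp =>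
      rw [smul_eq_mul, dirDeriv_mul, hp, hb p (hS ▸ hpS), mul_zero, zero_mul, add_zero]

/-- Derivations are the kernel of the Jacobian matrix over the function field, just as
`tangentSpace_eq_perp` gives the tangent space at a point as the kernel of its value there. -/
theorem range_derivationCoord {S : Set (MvPolynomial (Fin m) ℂ)} (hS : Ideal.span S = I) :
    LinearMap.range (derivationCoord I) =
      perp (spanFF I (fun (p : S) l => pderiv l p.1)) := by
  refine le_antisymm ?_ fun v hv => ?_
  · rintro _ ⟨D, rfl⟩
    have h : spanFF I (fun (p : S) l => pderiv l p.1) ≤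
        perp (Submodule.span _ {derivationCoord I D}) := by
      refine Submodule.span_le.2 ?_
      rintro _ ⟨p, rfl⟩ x hx
      obtain ⟨c, rfl⟩ := Submodule.mem_span_singleton.1 hx
      have h1 : p.1 ∈ I := hS ▸ Ideal.subset_span p.2
      have h2 := derivation_toFF D p.1
      rw [toFF_eq_zero.2 h1, map_zero] at h2
      rw [dotProduct_smul, dotProduct]
      exact (congrArg (c • ·) h2.symm).trans (smul_zero c)
    intro x hx
    rw [dotProduct_comm]
    exact h hx _ (Submodule.mem_span_singleton_self _)
  · have h : ∀ p ∈ I, ∑ l, toFF I (pderiv l p) * v l = 0 := by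
      intro p hp
      rw [← hS] at hp
      induction hp using Submodule.span_induction with
      | mem p hp =>
        have h1 := hv _ (Submodule.subset_span ⟨⟨p, hp⟩, rfl⟩)
        rw [dotProduct_comm] at h1
        exact h1
      | zero => simp
      | add p q _ _ hp hq =>
        simp only [map_add, add_mul, Finset.sum_add_distrib, hp, hq, add_zero]
      | smul a p hpS hp =>
        have h1 : toFF I p = 0 := toFF_eq_zero.2 (hS ▸ hpS)
        simp only [smul_eq_mul, (pderiv _).leibniz, map_add, map_mul, h1, zero_mul, add_zero,
          mul_assoc, ← Finset.mul_sum, hp, mul_zero]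
    obtain ⟨D, hD⟩ := exists_derivation_of_forall_mem v h
    exact ⟨D, funext hD⟩

variable (I) in
/-- The derivations of the function field have a polynomial generating family, whose values at a
general point generate the tangent space. -/
theorem exists_derivation_frame :
    ∃ (t : ℕ) (d : Fin t → Fin m → MvPolynomial (Fin m) ℂ)
      (D : Fin t → Derivation ℂ (FunctionField I) (FunctionField I)),
      Submodule.span (FunctionField I) (Set.range D) = ⊤ ∧
      (∀ e p, D e (toFF I p) = toFF I (∑ l, d e l * pderiv l p)) ∧
      Generally I fun b => tangentSpace I b = spanEval d b := by
  -- Finitely many equations are needed so that the Jacobian rows specialise together at a general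
  -- point.
  obtain ⟨S, hS⟩ := (isNoetherianRing_iff_ideal_fg _).1 inferInstance I
  obtain ⟨d, -, hd⟩ := exists_polynomial_frame (LinearMap.range (derivationCoord I))
  have h1 : ∀ e, (fun l => toFF I (d e l)) ∈ LinearMap.range (derivationCoord I) := fun e => by
    rw [← hd]
    exact Submodule.subset_span ⟨e, rfl⟩
  choose D hD using h1
  refine ⟨_, d, D, ?_, fun e p => ?_, ?_⟩
  · refine eq_top_iff.2 fun E _ => ?_
    have h2 : derivationCoord I E ∈
        Submodule.map (derivationCoord I) (Submodule.span _ (Set.range D)) := by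
      rw [Submodule.map_span, ← Set.range_comp,
        show (derivationCoord I : _ → _) ∘ D = fun j i => toFF I (d j i) from funext hD]
      change _ ∈ spanFF I d
      rw [hd]
      exact ⟨E, rfl⟩
    obtain ⟨E', hE', h3⟩ := h2
    rwa [← derivationCoord_injective h3]
  · rw [derivation_toFF, map_sum]
    refine Finset.sum_congr rfl fun l _ => ?_
    rw [map_mul, mul_comm]
    exact congrArg (· * _) (congrFun (hD e) l)
  · have h4 := generally_perp_eq (I := I)
      (f := fun (p : (S : Set (MvPolynomial (Fin m) ℂ))) l => pderiv l p.1) (s := d)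
      (by rw [hd, range_derivationCoord hS])
    exact h4.mono fun b hb h => (tangentSpace_eq_perp hS hb).trans h

end Tangent

/-! ### General points of a fibre. -/

section GenerallyVec

theorem GenerallyVec.exists {r : ℕ} {P Q : (Fin r → ℂ) → Prop} (hP : GenerallyVec P)
    (hQ : GenerallyVec Q) : ∃ a, P a ∧ Q a := by
  obtain ⟨p, hp, hP⟩ := hP
  obtain ⟨q, hq, hQ⟩ := hQ
  by_contra! hcon
  refine mul_ne_zero hp hq (MvPolynomial.funext fun a => ?_)
  by_contra ha
  rw [map_zero, map_mul] at ha
  have hc : ∀ p : MvPolynomial (Fin r) ℂ, aeval a p = eval a p :=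
    RingHom.congr_fun (coe_aeval_eq_eval a)
  rw [← hc, ← hc] at ha
  have h1 := left_ne_zero_of_mul ha
  have h2 := right_ne_zero_of_mul ha
  exact hcon a (hP a h1) (hQ a h2)

/-- A functional killing `W` but not `w j` would give a nonzero linear form in `a` that vanishes for
general `a`. -/
theorem GenerallyVec.mem_of_sum_smul_mem {r : ℕ} {V : Type*} [AddCommGroup V] [Module ℂ V]
    {W : Submodule ℂ V} {w : Fin r → V} (h : GenerallyVec fun a => ∑ j, a j • w j ∈ W)
    (j : Fin r) : w j ∈ W := by
  by_contra hj
  obtain ⟨f, hf, hW⟩ := Submodule.exists_le_ker_of_notMem hj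
  have h1 : GenerallyVec fun a : Fin r → ℂ => ∑ j, a j * f (w j) ≠ 0 := by
    refine ⟨∑ j, X j * C (f (w j)), fun h0 => hf ?_, fun a ha => ?_⟩
    · have := congrArg (aeval (Pi.single j 1 : Fin r → ℂ)) h0
      simpa [Pi.single_apply] using this
    · simpa using ha
  obtain ⟨a, ha, ha'⟩ := h.exists h1
  refine ha' ?_
  have := hW ha
  simpa using this

end GenerallyVec

/-! ### Specialisation of inclusions of spans. -/

section Specialization

variable {m : ℕ} {I : Ideal (MvPolynomial (Fin m) ℂ)} [hI : I.IsPrime]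
variable {n ι κ : Type*} [Fintype n] [Finite ι] [Finite κ]

theorem generally_spanEval_le {s : ι → n → MvPolynomial (Fin m) ℂ}
    {t : κ → n → MvPolynomial (Fin m) ℂ} (h : spanFF I s ≤ spanFF I t) :
    Generally I fun b => spanEval s b ≤ spanEval t b := by
  have h1 : ∀ j, Generally I fun b => (fun i => aeval b (s j i)) ∈ spanEval t b := fun j =>
    generally_mem_spanEval (h (Submodule.subset_span ⟨j, rfl⟩))
  refine (Generally.forall hI h1).mono fun b _ h2 => Submodule.span_le.2 ?_
  rintro _ ⟨j, rfl⟩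
  exact h2 j

theorem generally_spanEval_eq {s : ι → n → MvPolynomial (Fin m) ℂ}
    {t : κ → n → MvPolynomial (Fin m) ℂ} (h : spanFF I s = spanFF I t) :
    Generally I fun b => spanEval s b = spanEval t b :=
  ((generally_spanEval_le h.le).and hI (generally_spanEval_le h.ge)).mono
    fun _ _ h1 => le_antisymm h1.1 h1.2

end Specialization

/-! ### Generators of the tangent spaces along a section of a scroll. -/

section TangentFamily

variable {m : ℕ} {I : Ideal (MvPolynomial (Fin m) ℂ)} {N t : ℕ}

/-- The derivative of `p` along the polynomial vector field `v`. -/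
def fieldDeriv (v : Fin m → MvPolynomial (Fin m) ℂ) (p : MvPolynomial (Fin m) ℂ) :
    MvPolynomial (Fin m) ℂ := ∑ l, v l * pderiv l p

theorem aeval_fieldDeriv (v : Fin m → MvPolynomial (Fin m) ℂ) (p : MvPolynomial (Fin m) ℂ)
    (b : Fin m → ℂ) : aeval b (fieldDeriv v p) = dirDeriv b (fun l => aeval b (v l)) p := by
  simp only [fieldDeriv, dirDeriv, map_sum, map_mul]

namespace ParametricScroll

variable (X : ParametricScroll I N)

/-- The derivative of the `j`-th frame vector along the polynomial vector field `v`. -/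
def frameDeriv (v : Fin m → MvPolynomial (Fin m) ℂ) (j : Fin (X.k + 1)) (i : Fin (N + 1)) :
    MvPolynomial (Fin m) ℂ := fieldDeriv v (X.frame j i)

/-- Generators of the tangent spaces along the section with fibre coordinates `α`, given vector
fields `d`. -/
def tangentFamily (d : Fin t → Fin m → MvPolynomial (Fin m) ℂ)
    (α : Fin (X.k + 1) → MvPolynomial (Fin m) ℂ) :
    Fin (X.k + 1) ⊕ Fin t → Fin (N + 1) → MvPolynomial (Fin m) ℂ :=
  Sum.elim X.frame fun e i => ∑ j, α j * X.frameDeriv (d e) j i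

variable {d : Fin t → Fin m → MvPolynomial (Fin m) ℂ}

theorem spreadDiff_apply (b v : Fin m → ℂ) (a c : Fin (X.k + 1) → ℂ) :
    X.spreadDiff b a (v, c) = (∑ j, c j • fun i => aeval b (X.frame j i)) +
      ∑ j, a j • fun i => dirDeriv b v (X.frame j i) := by
  funext i
  simp [spreadDiff, Finset.sum_add_distrib]

theorem fibre_le_tangent (b : Fin m → ℂ) (a : Fin (X.k + 1) → ℂ) : X.fibre b ≤ X.tangent b a := by
  refine Submodule.span_le.2 ?_
  rintro _ ⟨j, rfl⟩
  refine ⟨(0, Pi.single j 1), ⟨Submodule.zero_mem _, trivial⟩, ?_⟩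
  rw [spreadDiff_apply]
  funext i
  simp [dirDeriv, Pi.single_apply]

theorem tangent_eq_span {b : Fin m → ℂ} (hb : tangentSpace I b = spanEval d b)
    (a : Fin (X.k + 1) → ℂ) :
    X.tangent b a = X.fibre b ⊔ Submodule.span ℂ (Set.range fun e =>
      ∑ j, a j • fun i => aeval b (X.frameDeriv (d e) j i)) := by
  have hdiff : ∀ e, (∑ j, a j • fun i => aeval b (X.frameDeriv (d e) j i)) =
      X.spreadDiff b a (fun l => aeval b (d e l), 0) := fun e => by
    rw [spreadDiff_apply]
    simp [frameDeriv, aeval_fieldDeriv]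
  refine le_antisymm ?_ (sup_le (X.fibre_le_tangent b a) ?_)
  · rintro _ ⟨⟨v, c⟩, ⟨hv, -⟩, rfl⟩
    have h1 : X.spreadDiff b a (v, c) = X.spreadDiff b a (0, c) + X.spreadDiff b a (v, 0) := by
      rw [← map_add]; simp
    rw [h1]
    refine Submodule.add_mem_sup ?_ ?_
    · rw [spreadDiff_apply]
      refine Submodule.add_mem _ (Submodule.sum_mem _ fun j _ =>
        Submodule.smul_mem _ _ (Submodule.subset_span ⟨j, rfl⟩)) ?_
      have : ∀ j i, dirDeriv b 0 (X.frame j i) = 0 := fun j i => by simp [dirDeriv]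
      simp only [this]
      exact Submodule.sum_mem _ fun j _ => Submodule.smul_mem _ _ (Submodule.zero_mem _)
    · simp only [hdiff]
      rw [SetLike.mem_coe, hb] at hv
      have h2 := Submodule.mem_map_of_mem (f := X.spreadDiff b a ∘ₗ LinearMap.inl ℂ _ _) hv
      rw [spanEval, Submodule.map_span, ← Set.range_comp] at h2
      exact h2
  · refine Submodule.span_le.2 ?_
    rintro _ ⟨e, rfl⟩
    refine ⟨_, ⟨?_, Submodule.zero_mem _⟩, (hdiff e).symm⟩
    rw [hb]
    exact Submodule.subset_span ⟨e, rfl⟩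

theorem tangent_eq_spanEval {b : Fin m → ℂ} (hb : tangentSpace I b = spanEval d b)
    (α : Fin (X.k + 1) → MvPolynomial (Fin m) ℂ) :
    X.tangent b (fun j => aeval b (α j)) = spanEval (X.tangentFamily d α) b := by
  rw [tangent_eq_span X hb, spanEval,
    show (fun j i => aeval b (X.tangentFamily d α j i)) =
      Sum.elim (fun j i => aeval b (X.frame j i))
        (fun e => ∑ j, aeval b (α j) • fun i => aeval b (X.frameDeriv (d e) j i)) from ?_,
    Set.Sum.elim_range, Submodule.span_union]
  · rfl
  · funext x i
    cases x with
    | inl j => rfl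
    | inr e => simp [tangentFamily]

variable [hI : I.IsPrime]
variable {D : Fin t → Derivation ℂ (FunctionField I) (FunctionField I)}

/-- By the Leibniz rule, differentiating the coefficients `α j` only adds vectors of the fibre, so
modulo the fibre the section's derivatives are the weighted derivatives of the frame. -/
theorem spanFF_tangentFamily (hD : Submodule.span (FunctionField I) (Set.range D) = ⊤)
    (hDd : ∀ e p, D e (toFF I p) = toFF I (fieldDeriv (d e) p))
    (α : Fin (X.k + 1) → MvPolynomial (Fin m) ℂ) :
    spanFF I (X.tangentFamily d α) = spanFF I X.frame ⊔
      LinearMap.range (derAt ℂ (∑ j, toFF I (α j) • fun i => toFF I (X.frame j i))) := by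
  have hder : ∀ e, derVec (D e) (∑ j, toFF I (α j) • fun i => toFF I (X.frame j i)) =
      (∑ j, D e (toFF I (α j)) • fun i => toFF I (X.frame j i)) +
        fun i => toFF I (X.tangentFamily d α (Sum.inr e) i) := fun e => by
    funext i
    simp [derVec, tangentFamily, frameDeriv, ← hDd, (D e).leibniz, Finset.sum_add_distrib,
      mul_comm, add_comm]
  have hmem : ∀ e, (∑ j, D e (toFF I (α j)) • fun i => toFF I (X.frame j i)) ∈
      spanFF I X.frame := fun e =>
    Submodule.sum_mem _ fun j _ => Submodule.smul_mem _ _ (Submodule.subset_span ⟨j, rfl⟩)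
  have hle : spanFF I X.frame ≤ spanFF I (X.tangentFamily d α) := by
    refine Submodule.span_mono ?_
    rintro _ ⟨j, rfl⟩
    exact ⟨Sum.inl j, rfl⟩
  refine le_antisymm ?_ (sup_le hle ?_)
  · refine Submodule.span_le.2 ?_
    rintro _ ⟨j | e, rfl⟩
    · exact Submodule.mem_sup_left (Submodule.subset_span ⟨j, rfl⟩)
    · have h1 := hder e
      rw [← sub_eq_iff_eq_add'] at h1
      change (fun i => toFF I (X.tangentFamily d α (Sum.inr e) i)) ∈ _
      rw [← h1]
      exact Submodule.sub_mem _ (Submodule.mem_sup_right ⟨D e, rfl⟩)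
        (Submodule.mem_sup_left (hmem e))
  · rw [LinearMap.range_eq_map, ← hD, Submodule.map_span]
    refine Submodule.span_le.2 ?_
    rintro _ ⟨_, ⟨e, rfl⟩, rfl⟩
    change derVec (D e) _ ∈ _
    rw [hder]
    exact Submodule.add_mem _ (hle (hmem e)) (Submodule.subset_span ⟨Sum.inr e, rfl⟩)

theorem derVec_mem_of_frameDeriv (hD : Submodule.span (FunctionField I) (Set.range D) = ⊤)
    (hDd : ∀ e p, D e (toFF I p) = toFF I (fieldDeriv (d e) p))
    {U' : Submodule (FunctionField I) (Fin (N + 1) → FunctionField I)}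
    (hle : spanFF I X.frame ≤ U') (h : ∀ e j, (fun i => toFF I (X.frameDeriv (d e) j i)) ∈ U')
    {u : Fin (N + 1) → FunctionField I} (hu : u ∈ spanFF I X.frame)
    (E : Derivation ℂ (FunctionField I) (FunctionField I)) : derVec E u ∈ U' := by
  have hE : E ∈ Submodule.span (FunctionField I) (Set.range D) := hD ▸ Submodule.mem_top
  induction hE using Submodule.span_induction with
  | mem E hE =>
    obtain ⟨e, rfl⟩ := hE
    induction hu using Submodule.span_induction with
    | mem u hu =>
      obtain ⟨j, rfl⟩ := hu
      convert h e j using 1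
      funext i
      exact hDd e _
    | zero =>
      convert U'.zero_mem using 1
      funext i
      exact map_zero _
    | add x y _ _ hx hy =>
      rw [derVec_add]
      exact U'.add_mem hx hy
    | smul c x hxS hx =>
      rw [derVec_smul]
      exact U'.add_mem (U'.smul_mem _ hx) (U'.smul_mem _ (hle hxS))
  | zero => exact U'.zero_mem
  | add x y _ _ hx hy => exact U'.add_mem hx hy
  | smul c x _ hx => exact U'.smul_mem c hx

end ParametricScroll

end TangentFamily

/-! ### The dictionary between tangential scrolls and derived spaces. -/

section Derived

variable {m : ℕ} {I : Ideal (MvPolynomial (Fin m) ℂ)} [hI : I.IsPrime] {N : ℕ}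

namespace ParametricScroll

/-- The two inclusions lift from general points. For a generator, fix a general `b` and a general
`a` in its fibre, and extend `a` to a constant section: its tangent space at `b` already has the
rank of `T`, and the rank at the generic point is no smaller. -/
theorem IsDerived.isDerivedSpace {X T : ParametricScroll I N} (h : X.IsDerived T) :
    IsDerivedSpace ℂ (spanFF I X.frame) (spanFF I T.frame) := by
  obtain ⟨t, d, D, hD, hDd, htan⟩ := exists_derivation_frame I
  have hle : spanFF I X.frame ≤ spanFF I T.frame := by
    refine Submodule.span_le.2 ?_
    rintro _ ⟨j, rfl⟩
    refine mem_spanFF_of_generally (h.2.mono fun b _ hb => ?_)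
    obtain ⟨a, ha, -⟩ := hb.exists hb
    change _ ∈ T.fibre b
    rw [ha]
    exact X.fibre_le_tangent b a (Submodule.subset_span ⟨j, rfl⟩)
  have hfr : ∀ e j, (fun i => toFF I (X.frameDeriv (d e) j i)) ∈ spanFF I T.frame := by
    intro e j
    refine mem_spanFF_of_generally ((h.2.and hI htan).mono fun b _ hb => ?_)
    change _ ∈ T.fibre b
    refine GenerallyVec.mem_of_sum_smul_mem
      (w := fun j i => aeval b (X.frameDeriv (d e) j i)) ?_ j
    obtain ⟨q, hq, hqa⟩ := hb.1
    refine ⟨q, hq, fun a ha => ?_⟩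
    rw [hqa a ha, X.tangent_eq_span hb.2]
    exact Submodule.mem_sup_right (Submodule.subset_span ⟨e, rfl⟩)
  have hder := fun u (hu : u ∈ spanFF I X.frame) => X.derVec_mem_of_frameDeriv hD hDd hle hfr hu
  refine ⟨hle, hder, ?_⟩
  obtain ⟨b, hb, ⟨hbT, hbtan⟩, hbr⟩ :=
    ((h.2.and hI htan).and hI (generally_finrank_eq T.frame)).exists hI
  obtain ⟨a, ha, -⟩ := hbT.exists hbT
  have h1 := X.tangent_eq_spanEval hbtan fun j => C (a j)
  simp only [aeval_C, Algebra.algebraMap_self, RingHom.id_apply] at h1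
  have hu : (∑ j, toFF I (C (a j)) • fun i => toFF I (X.frame j i)) ∈ spanFF I X.frame :=
    Submodule.sum_mem _ fun j _ => Submodule.smul_mem _ _ (Submodule.subset_span ⟨j, rfl⟩)
  refine ⟨_, hu, ?_⟩
  have h2 := X.spanFF_tangentFamily hD hDd fun j => C (a j)
  have h3 : spanFF I (X.tangentFamily d fun j => C (a j)) ≤ spanFF I T.frame := by
    rw [h2]
    refine sup_le hle ?_
    rintro _ ⟨E, rfl⟩
    exact hder _ hu E
  rw [← h2]
  refine (Submodule.eq_of_le_of_finrank_le h3 ?_).ge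
  rw [← hbr]
  change Module.finrank ℂ (T.fibre b) ≤ _
  rw [ha, h1]
  exact finrank_spanEval_le _ hb

theorem exists_polynomial_section {X : ParametricScroll I N}
    {u : Fin (N + 1) → FunctionField I} (hu : u ∈ spanFF I X.frame) :
    ∃ α : Fin (X.k + 1) → MvPolynomial (Fin m) ℂ, ∃ q : FunctionField I, q ≠ 0 ∧
      ∑ j, toFF I (α j) • (fun i => toFF I (X.frame j i)) = q • u := by
  obtain ⟨c, hc⟩ := (Submodule.mem_span_range_iff_exists_fun _).1 hu
  obtain ⟨q, hq, p, hp⟩ := exists_common_denominator c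
  refine ⟨p, toFF I q, fun h => hq (toFF_eq_zero.1 h), ?_⟩
  rw [← hc, Finset.smul_sum]
  exact Finset.sum_congr rfl fun j _ => by rw [hp, mul_smul]

/-- A generator, cleared of denominators, is a section along which the tangent space at a general
`b` is all of `T_b`. Every tangent space over `b` is contained in `T_b`, and having maximal rank is
an open condition on the fibre coordinates. -/
theorem isDerived_of_isDerivedSpace {X T : ParametricScroll I N}
    (h : IsDerivedSpace ℂ (spanFF I X.frame) (spanFF I T.frame)) : X.IsDerived T := by
  obtain ⟨t, d, D, hD, hDd, htan⟩ := exists_derivation_frame I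
  obtain ⟨u, hu, hgen⟩ := h.exists_gen
  obtain ⟨α, q, hq, hα⟩ := exists_polynomial_section hu
  have hqu : q • u ∈ spanFF I X.frame := Submodule.smul_mem _ _ hu
  have h1 : spanFF I T.frame = spanFF I (X.tangentFamily d α) := by
    rw [X.spanFF_tangentFamily hD hDd, hα]
    refine le_antisymm (hgen.trans (sup_le le_sup_left ?_)) (sup_le h.le ?_)
    · rintro _ ⟨E, rfl⟩
      have h2 : derAt ℂ u E = q⁻¹ • (derVec E (q • u) - E q • u) := by
        rw [derVec_smul, add_sub_cancel_right, smul_smul, inv_mul_cancel₀ hq, one_smul]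
        rfl
      rw [h2]
      exact Submodule.smul_mem _ _ (Submodule.sub_mem _ (Submodule.mem_sup_right ⟨E, rfl⟩)
        (Submodule.mem_sup_left (Submodule.smul_mem _ _ hu)))
    · rintro _ ⟨E, rfl⟩
      exact h.derVec_mem _ hqu E
  have h2 : ∀ x : Fin t × Fin (X.k + 1), Generally I fun b =>
      (fun i => aeval b (X.frameDeriv (d x.1) x.2 i)) ∈ spanEval T.frame b := fun x => by
    refine generally_mem_spanEval ?_
    convert h.derVec_mem _ (Submodule.subset_span ⟨x.2, rfl⟩) (D x.1) using 1
    funext i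
    exact (hDd _ _).symm
  have hmain : Generally I fun b => GenerallyVec fun a => T.fibre b = X.tangent b a := by
    refine ((htan.and hI (Generally.forall hI h2)).and hI ((generally_spanEval_eq h1).and hI
      (generally_spanEval_le h.le))).mono ?_
    rintro b - ⟨⟨hbtan, hbd⟩, hbeq, hble⟩
    have hle : ∀ a, X.tangent b a ≤ T.fibre b := fun a => by
      rw [X.tangent_eq_span hbtan]
      refine sup_le hble (Submodule.span_le.2 ?_)
      rintro _ ⟨e, rfl⟩
      exact Submodule.sum_mem _ fun j _ => Submodule.smul_mem _ _ (hbd (e, j))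
    have heq : T.fibre b = X.tangent b fun j => aeval b (α j) :=
      hbeq.trans (X.tangent_eq_spanEval hbtan α).symm
    -- With `b` fixed, the generators of the tangent space are polynomial in `a`; a determinant
    -- nonzero at the point of the section then defines the open set of good `a`.
    let fam : Fin (X.k + 1) ⊕ Fin t → Fin (N + 1) → MvPolynomial (Fin (X.k + 1)) ℂ :=
      Sum.elim (fun j i => C (aeval b (X.frame j i)))
        fun e i => ∑ j, MvPolynomial.X j * C (aeval b (X.frameDeriv (d e) j i))
    have hfam : ∀ a, X.tangent b a = Submodule.span ℂ
        (Set.range fun x i => aeval a (fam x i)) := fun a => by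
      rw [X.tangent_eq_span hbtan, show (fun x i => aeval a (fam x i)) =
        Sum.elim (fun j i => aeval b (X.frame j i))
          (fun e => ∑ j, a j • fun i => aeval b (X.frameDeriv (d e) j i)) from ?_,
        Set.Sum.elim_range, Submodule.span_union]
      · rfl
      · funext x i
        cases x with
        | inl j => simp [fam]
        | inr e => simp [fam]
    obtain ⟨f, hf⟩ := exists_subfamily_basis (k := ℂ)
      fun x i => aeval (fun j => aeval b (α j)) (fam x i)
    obtain ⟨r, hr, hL⟩ := exists_ne_zero_forall_linearIndependent
      (aeval fun j => aeval b (α j)) (s := fam ∘ f) hf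
    refine ⟨r, fun h0 => hr (by rw [h0, map_zero]), fun a ha => ?_⟩
    refine (Submodule.eq_of_le_of_finrank_le (hle a) ?_).symm
    have h3 := card_le_finrank_span_of_comp (v := fun x i => aeval a (fam x i)) (e := f)
      (hL ℂ (aeval a).toRingHom ha)
    rw [← hfam, ← hfam, ← heq] at h3
    exact h3
  exact ⟨hmain.mono fun b _ hb => ⟨T.fibre b, by
    obtain ⟨q, hq, hqa⟩ := hb
    exact ⟨q, hq, fun a ha => (hqa a ha).symm⟩⟩, hmain⟩

/-- The linear dual of a scroll whose general fibre is not the whole projective space. -/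
theorem exists_dual (X : ParametricScroll I N) (hX : perp (spanFF I X.frame) ≠ ⊥) :
    ∃ W : ParametricScroll I N, spanFF I W.frame = perp (spanFF I X.frame) ∧
      X.IsLinearDual W ∧ W.k + 1 = Module.finrank (FunctionField I) (perp (spanFF I X.frame)) := by
  obtain ⟨k, hk⟩ := Nat.exists_eq_succ_of_ne_zero (Submodule.finrank_eq_zero.not.2 hX)
  have h1 := exists_polynomial_frame (perp (spanFF I X.frame))
  rw [hk] at h1
  obtain ⟨s, hs, hU⟩ := h1
  have hdual := generally_perp_eq hU.symm
  obtain ⟨p, hp, hpfin⟩ := X.genFinite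
  obtain ⟨q, hq, hqd⟩ := hdual
  refine ⟨⟨k, s, generally_linearIndependent hs, p * q,
    fun h => (hI.mem_or_mem h).elim hp hq, fun b hb hpq => ?_⟩, hU, ?_, hk.symm⟩
  · rw [map_mul] at hpq
    refine (hpfin b hb (left_ne_zero_of_mul hpq)).subset ?_
    rintro b' ⟨hb', hpq', heq⟩
    rw [map_mul] at hpq'
    refine ⟨hb', left_ne_zero_of_mul hpq', ?_⟩
    have h2 := hqd b hb (right_ne_zero_of_mul hpq)
    have h3 := hqd b' hb' (right_ne_zero_of_mul hpq')
    -- The double complement recovers the fibre of `X`, so generic finiteness passes to the dual.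
    have h4 : perp (spanEval X.frame b') = perp (spanEval X.frame b) :=
      h3.trans (Eq.trans heq h2.symm)
    have h5 := congrArg perp h4
    rwa [perp_perp, perp_perp] at h5
  · refine ⟨q, hq, fun b hb hqb ξ => ?_⟩
    change ξ ∈ spanEval s b ↔ _
    rw [← hqd b hb hqb]
    rfl

end ParametricScroll

end Derived

/-! ### Krull dimension, transcendence degree and dual derivations. -/

section Dimension

/-- Incomparability bounds the dimension of `S` above; lying over and going up lift chains of primes
from `R`. -/
theorem ringKrullDim_eq_of_isIntegral (R S : Type*) [CommRing R] [CommRing S] [Algebra R S]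
    [Algebra.IsIntegral R S] [FaithfulSMul R S] : ringKrullDim S = ringKrullDim R := by
  refine le_antisymm ?_ ?_
  · refine Order.krullDim_le_of_strictMono (PrimeSpectrum.comap (algebraMap R S)) fun P Q h => ?_
    exact Ideal.IsIntegral.comap_lt_comap (R := R) h
  · refine iSup_le fun l => ?_
    obtain ⟨⟨Q, hQ, hQl⟩⟩ := Ideal.nonempty_primesOver (S := S) l.head.asIdeal
    obtain ⟨l', hl', -⟩ := Ideal.exists_ltSeries_of_hasGoingUp (S := S) l Q
    rw [← hl']
    exact le_iSup (fun l : LTSeries (PrimeSpectrum S) => (l.length : WithBot ℕ∞)) l'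

theorem exists_algebraicIndependent_of_finiteType (k S : Type) [Field k] [CommRing S] [IsDomain S]
    [Algebra k S] [Algebra.FiniteType k S] :
    ∃ (n : ℕ) (x : Fin n → S), AlgebraicIndependent k x ∧ ringKrullDim S = (n : WithBot ℕ∞) ∧
      Algebra.trdeg k S = n := by
  obtain ⟨n, g, hg, hint⟩ := exists_integral_inj_algHom_of_fg k S
  let := g.toRingHom.toAlgebra
  have : IsScalarTower k (MvPolynomial (Fin n) k) S :=
    IsScalarTower.of_algebraMap_eq fun r => (g.commutes r).symm
  have : Algebra.IsIntegral (MvPolynomial (Fin n) k) S := ⟨hint⟩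
  have : FaithfulSMul (MvPolynomial (Fin n) k) S :=
    (faithfulSMul_iff_algebraMap_injective _ _).2 hg
  refine ⟨n, fun i => g (X i), ?_, ?_, ?_⟩
  · have h : (aeval fun i => g (X i)) = g := by
      ext i
      simp
    unfold AlgebraicIndependent
    rw [h]
    exact hg
  · rw [ringKrullDim_eq_of_isIntegral (MvPolynomial (Fin n) k) S,
      MvPolynomial.ringKrullDim_of_isNoetherianRing]
    simp
  · rw [← trdeg_add_eq k (MvPolynomial (Fin n) k) (A := S),
      trdeg_eq_zero (R := MvPolynomial (Fin n) k) (A := S), MvPolynomial.trdeg_of_isDomain]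
    simp

/-- An algebraically independent family in a field of characteristic zero is dual to a family of
derivations. -/
theorem exists_derivation_of_algebraicIndependent {k L : Type*} [Field k] [CharZero k] [Field L]
    [Algebra k L] {n : ℕ} {z : Fin n → L} (hz : AlgebraicIndependent k z) (i : Fin n) :
    ∃ D : Derivation k L L, ∀ j, D (z j) = if i = j then 1 else 0 := by
  classical
  -- In characteristic zero `L` is separable algebraic over the rational functions in a
  -- transcendence basis, hence formally étale over the polynomial ring. A derivation may thus be
  -- prescribed freely on the basis.
  obtain ⟨s, hs, hbasis⟩ := exists_isTranscendenceBasis_superset hz.to_subtype_range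
  have hinj : Function.Injective (aeval (Subtype.val : s → L) : MvPolynomial s k →ₐ[k] L) := hbasis.1
  let := (aeval (Subtype.val : s → L) : MvPolynomial s k →ₐ[k] L).toRingHom.toAlgebra
  have hmap : ∀ p : MvPolynomial s k, algebraMap (MvPolynomial s k) L p =
      aeval (Subtype.val : s → L) p := fun _ => rfl
  have : IsScalarTower k (MvPolynomial s k) L :=
    IsScalarTower.of_algebraMap_eq fun r => by simp [hmap]
  have : FaithfulSMul (MvPolynomial s k) L := (faithfulSMul_iff_algebraMap_injective _ _).2 hinj
  have : Algebra.IsAlgebraic (MvPolynomial s k) L := by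
    have h1 := hbasis.isAlgebraic
    refine ⟨fun x => ?_⟩
    have h2 := h1.isAlgebraic x
    obtain ⟨p, hp, hpx⟩ := h2
    let e := hbasis.1.aevalEquiv
    refine ⟨p.map e.symm.toRingHom, (Polynomial.map_ne_zero_iff e.symm.injective).2 hp, ?_⟩
    have h3 : (algebraMap (MvPolynomial s k) L).comp e.symm.toRingEquiv.toRingHom =
        algebraMap (Algebra.adjoin k (Set.range (Subtype.val : s → L))) L := RingHom.ext fun y => by
      change aeval (Subtype.val : s → L) (e.symm y) = _
      rw [← hbasis.1.algebraMap_aevalEquiv]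
      exact congrArg Subtype.val (e.apply_symm_apply y)
    rw [Polynomial.aeval_def, Polynomial.eval₂_map]
    rw [Polynomial.aeval_def, ← h3] at hpx
    exact hpx
  let E := FractionRing (MvPolynomial s k)
  let : Algebra E L := FractionRing.liftAlgebra _ _
  have : CharZero E := charZero_of_injective_algebraMap (algebraMap k E).injective
  have : Algebra.IsAlgebraic E L := Algebra.IsAlgebraic.extendScalars
    (R := MvPolynomial s k) (IsFractionRing.injective (MvPolynomial s k) E)
  have : Algebra.FormallyEtale (MvPolynomial s k) E :=
    Algebra.FormallyEtale.of_isLocalization (nonZeroDivisors (MvPolynomial s k))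
  have : Algebra.FormallyEtale E L := Algebra.FormallyEtale.of_isSeparable E L
  have : Algebra.FormallyEtale (MvPolynomial s k) L := Algebra.FormallyEtale.comp _ E _
  obtain ⟨D, hD⟩ := exists_derivation_extension
    (mkDerivation k fun x : s => if x.val = z i then (1 : L) else 0)
  refine ⟨D, fun j => ?_⟩
  have h1 := hD (X ⟨z j, hs ⟨j, rfl⟩⟩)
  rw [hmap, aeval_X, mkDerivation_X] at h1
  rw [h1]
  simp only [hz.injective.eq_iff, eq_comm]

end Dimension

/-! ### From a finite fibre to quasi-finiteness at the generic point. -/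

section Finiteness

theorem exists_algHom_ker_eq {S : Type*} [CommRing S] [Algebra ℂ S] [Algebra.FiniteType ℂ S]
    (M : Ideal S) [hM : M.IsMaximal] : ∃ ψ : S →ₐ[ℂ] ℂ, RingHom.ker ψ = M := by
  let := Ideal.Quotient.field M
  have h1 : Algebra.FiniteType ℂ (S ⧸ M) :=
    Algebra.FiniteType.of_surjective (Ideal.Quotient.mkₐ ℂ M) (Ideal.Quotient.mkₐ_surjective ℂ M)
  have h2 : Module.Finite ℂ (S ⧸ M) := finite_of_finite_type_of_isJacobsonRing ℂ (S ⧸ M)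
  let e : ℂ ≃ₐ[ℂ] (S ⧸ M) := AlgEquiv.ofBijective (Algebra.ofId ℂ (S ⧸ M))
    IsAlgClosed.algebraMap_bijective_of_isIntegral
  refine ⟨e.symm.toAlgHom.comp (Ideal.Quotient.mkₐ ℂ M), ?_⟩
  ext x
  rw [RingHom.mem_ker]
  change e.symm (Ideal.Quotient.mk M x) = 0 ↔ _
  rw [map_eq_zero_iff _ e.symm.injective, Ideal.Quotient.eq_zero_iff_mem]

theorem algHom_eq_of_ker_le {R : Type*} [CommRing R] [Algebra ℂ R] {φ ψ : R →ₐ[ℂ] ℂ}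
    (h : RingHom.ker φ ≤ RingHom.ker ψ) : ψ = φ := by
  ext x
  have h1 : x - algebraMap ℂ R (φ x) ∈ RingHom.ker φ := by
    rw [RingHom.mem_ker, map_sub, AlgHom.commutes]
    exact sub_self _
  have h2 := h h1
  rw [RingHom.mem_ker, map_sub, AlgHom.commutes, sub_eq_zero] at h2
  exact h2

/-- If a point of an affine variety is one of finitely many points in its fibre under a map, then
the function field is quasi-finite over the target. -/
theorem quasiFinite_of_finite_fibre {R S K : Type} [CommRing R] [CommRing S] [IsDomain S]
    [Field K] [Algebra ℂ R] [Algebra ℂ S] [Algebra R S] [Algebra S K] [Algebra R K]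
    [IsScalarTower ℂ R S] [IsScalarTower R S K] [IsFractionRing S K] [Algebra.FiniteType ℂ S]
    (q : S →ₐ[ℂ] ℂ)
    (hq : {ψ : S →ₐ[ℂ] ℂ | ∀ r : R, ψ (algebraMap R S r) = q (algebraMap R S r)}.Finite) :
    Algebra.QuasiFinite R K := by
  have : IsJacobsonRing S := isJacobsonRing_of_finiteType (A := ℂ)
  have hmax : ∀ ψ : S →ₐ[ℂ] ℂ, (RingHom.ker ψ).IsMaximal := fun ψ =>
    RingHom.ker_isMaximal_of_surjective ψ fun c => ⟨algebraMap ℂ S c, ψ.commutes c⟩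
  let Q : PrimeSpectrum S := ⟨RingHom.ker q, (hmax q).isPrime⟩
  let F : Set (PrimeSpectrum S) :=
    PrimeSpectrum.comap (algebraMap R S) ⁻¹' {PrimeSpectrum.comap (algebraMap R S) Q}
  have hpoint : ∀ P ∈ F, ∀ M : Ideal S, P.asIdeal ≤ M → M.IsMaximal →
      ∃ ψ : S →ₐ[ℂ] ℂ, (∀ r : R, ψ (algebraMap R S r) = q (algebraMap R S r)) ∧
        RingHom.ker ψ = M := by
    intro P hP M hPM hM
    obtain ⟨ψ, hψ⟩ := exists_algHom_ker_eq M
    refine ⟨ψ, fun r => ?_, hψ⟩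
    have h1 : ψ.comp (IsScalarTower.toAlgHom ℂ R S) = q.comp (IsScalarTower.toAlgHom ℂ R S) := by
      refine algHom_eq_of_ker_le fun x hx => ?_
      have h2 : x ∈ (PrimeSpectrum.comap (algebraMap R S) Q).asIdeal := hx
      rw [← show _ = PrimeSpectrum.comap (algebraMap R S) Q from hP] at h2
      have h3 : algebraMap R S x ∈ RingHom.ker ψ := hψ ▸ hPM h2
      exact h3
    exact DFunLike.congr_fun h1 r
  have hF : ∀ P ∈ F, ∃ ψ : S →ₐ[ℂ] ℂ,
      (∀ r : R, ψ (algebraMap R S r) = q (algebraMap R S r)) ∧ RingHom.ker ψ = P.asIdeal := by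
    intro P hP
    classical
    -- In a Jacobson ring `P` is the intersection of the maximal ideals above it. These are kernels
    -- of the finitely many points in the fibre, so the prime `P` is one of them.
    have h1 : hq.toFinset.inf (fun ψ : S →ₐ[ℂ] ℂ =>
        if P.asIdeal ≤ RingHom.ker ψ then RingHom.ker ψ else ⊤) ≤ P.asIdeal := by
      have h2 : P.asIdeal.jacobson = P.asIdeal := isJacobsonRing_iff_prime_eq.1 this _ P.2
      conv_rhs => rw [← h2]
      refine le_sInf fun M hM => ?_
      obtain ⟨ψ, hψ, rfl⟩ := hpoint P hP M hM.1 hM.2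
      refine (Finset.inf_le (hq.mem_toFinset.2 hψ)).trans ?_
      rw [if_pos hM.1]
    obtain ⟨ψ, hψ, h3⟩ := (Ideal.IsPrime.inf_le' P.2).1 h1
    split_ifs at h3 with h4
    · exact ⟨ψ, hq.mem_toFinset.1 hψ, le_antisymm h3 h4⟩
    · exact absurd (top_le_iff.1 h3) P.2.ne_top
  have hfin : F.Finite := by
    refine (hq.image fun ψ => (⟨RingHom.ker ψ, (hmax ψ).isPrime⟩ : PrimeSpectrum S)).subset ?_
    intro P hP
    obtain ⟨ψ, hψ, h⟩ := hF P hP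
    exact ⟨ψ, hψ, PrimeSpectrum.ext h⟩
  have : Finite F := hfin
  have : T1Space F := ⟨fun P => by
    obtain ⟨ψ, -, h⟩ := hF P.1 P.2
    have h1 : IsClosed {P.1} := by
      rw [PrimeSpectrum.isClosed_singleton_iff_isMaximal, ← h]
      exact hmax ψ
    convert h1.preimage (continuous_subtype_val : Continuous ((↑) : F → PrimeSpectrum S)) using 1
    ext x
    simp [Subtype.ext_iff]⟩
  have : Algebra.FiniteType R S := Algebra.FiniteType.of_restrictScalars_finiteType ℂ R S
  -- A finite T1 fibre is discrete, so `Q` is isolated in it. Quasi-finiteness at `Q` then passes to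
  -- the smaller prime `⊥`, whose local ring is `K`.
  have hQ : Algebra.QuasiFiniteAt R Q.asIdeal :=
    Algebra.QuasiFiniteAt.of_isOpen_singleton_fiber Q (isOpen_discrete (α := F) _)
  have hbot : Algebra.QuasiFiniteAt R (⊥ : Ideal S) :=
    Algebra.QuasiFiniteAt.of_le (Q := Q.asIdeal) bot_le
  have : IsLocalization (⊥ : Ideal S).primeCompl K := by
    rw [show (⊥ : Ideal S).primeCompl = nonZeroDivisors S by
      ext x; simp [Ideal.mem_primeCompl_iff]]
    infer_instance
  exact (Algebra.QuasiFinite.iff_of_algEquiv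
    ((IsLocalization.algEquiv (⊥ : Ideal S).primeCompl
      (Localization.AtPrime (⊥ : Ideal S)) K).restrictScalars R)).1 hbot

end Finiteness

/-! ### Algebraic extensions and derivations. -/

section Algebraic

theorem isAlgebraic_algebraMap_of_intermediateField {k S K L : Type*} [Field k] [CommRing S]
    [IsDomain S] [Field K] [Field L] [Algebra k K] [Algebra S L] [FaithfulSMul S L] [Algebra K L]
    (E : IntermediateField k K) [Algebra.IsAlgebraic E K]
    (hE : ∀ e ∈ E, IsAlgebraic S (algebraMap K L e)) (x : K) :
    IsAlgebraic S (algebraMap K L x) := by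
  let f : E →+* Subalgebra.algebraicClosure S L :=
    ((algebraMap K L).comp (algebraMap E K)).codRestrict (Subalgebra.algebraicClosure S L)
      fun e => hE e e.2
  obtain ⟨p, hp, hpx⟩ := Algebra.IsAlgebraic.isAlgebraic (R := E) x
  have h1 : IsAlgebraic (Subalgebra.algebraicClosure S L) (algebraMap K L x) := by
    refine ⟨p.map f, (Polynomial.map_ne_zero_iff f.injective).2 hp, ?_⟩
    rw [Polynomial.aeval_def, Polynomial.eval₂_map]
    rw [Polynomial.aeval_def] at hpx
    have h2 := congrArg (algebraMap K L) hpx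
    rw [Polynomial.hom_eval₂, map_zero] at h2
    exact h2
  exact h1.restrictScalars S

/-- Such a `D` is `E`-linear, and the differentials of `K` over `E` vanish because algebraic
extensions are separable in characteristic zero. -/
theorem derivation_eq_zero_of_isAlgebraic {k K : Type*} [Field k] [CharZero k] [Field K]
    [Algebra k K] (E : IntermediateField k K) [Algebra.IsAlgebraic E K] (D : Derivation k K K)
    (hD : ∀ e ∈ E, D e = 0) : D = 0 := by
  have : CharZero E := charZero_of_injective_algebraMap (algebraMap k E).injective
  have : Algebra.FormallyUnramified E K := Algebra.FormallyUnramified.of_isSeparable E K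
  let D' : Derivation E K K := Derivation.mk'
    { toFun := D
      map_add' := map_add D
      map_smul' := fun e x => by
        rw [Algebra.smul_def, D.leibniz]
        have : D (algebraMap E K e) = 0 := hD e e.2
        rw [this, smul_zero, add_zero]
        rfl } D.leibniz
  have h1 : D' = 0 := by
    ext x
    rw [← D'.liftKaehlerDifferential_comp_D x, Subsingleton.elim (KaehlerDifferential.D E K x) 0]
    simp
  ext x
  exact DFunLike.congr_fun h1 x

end Algebraic

/-! ### A lower bound for the dimension of the derived space. -/

section GenericDimension

theorem linearIndependent_algebraMap {K L n ι : Type*} [Field K] [Field L] [Algebra K L]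
    [Fintype n] [Finite ι] {v : ι → n → K} (hv : LinearIndependent K v) :
    LinearIndependent L fun i l => algebraMap K L (v i l) := by
  classical
  obtain ⟨w, hw⟩ := LinearIndependent.exists_dotProduct hv
  refine linearIndependent_of_dotProduct (w := fun i l => algebraMap K L (w i l)) one_ne_zero
    fun i j => ?_
  have h := congrArg (algebraMap K L) (hw i j)
  simp only [dotProduct, map_sum, map_mul] at h
  rw [dotProduct, h, apply_ite (algebraMap K L), map_one, map_zero]

variable {k K L : Type*} [Field k] [Field K] [Field L] [Algebra k K] [Algebra k L] [Algebra K L]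
  [IsScalarTower k K L] {n ι : Type*} [Fintype n] [Fintype ι] {U : Submodule K (n → K)}

/-- Restricted to `K` and followed by a `K`-linear functional on `L`, `E` becomes a derivation of
`K` to itself, to which `hs` applies. Such functionals separate the elements of `L`. -/
theorem sum_smul_derivation_eq_zero {s : n → K} (hs : ∀ D : Derivation k K K, derVec D s ∈ U)
    {ξ : n → K} (hξ : ξ ∈ perp U) (E : Derivation k L L) :
    ∑ l, ξ l • E (algebraMap K L (s l)) = 0 := by
  refine (Module.forall_dual_apply_eq_zero_iff K _).1 fun f => ?_
  rw [map_sum]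
  simp only [map_smul]
  exact hξ _ (hs (f.compDer (E.compAlgebraMap K)))

theorem sum_algebraMap_mul_derivation_eq_zero {s : ι → n → K} (hs : ∀ j, s j ∈ U)
    (hder : ∀ j, ∀ D : Derivation k K K, derVec D (s j) ∈ U) {c : ι → L} {x : n → L}
    (hx : ∀ l, x l = ∑ j, c j * algebraMap K L (s j l)) {ξ : n → K} (hξ : ξ ∈ perp U)
    (E : Derivation k L L) : ∑ l, algebraMap K L (ξ l) * E (x l) = 0 := by
  have h0 : ∀ j, ∑ l, algebraMap K L (ξ l) * algebraMap K L (s j l) = 0 := fun j => by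
    have h := congrArg (algebraMap K L) (hξ _ (hs j))
    simpa only [dotProduct, map_sum, map_mul, map_zero] using h
  have h1 : ∀ l, algebraMap K L (ξ l) * E (x l) =
      ∑ j, (c j * (ξ l • E (algebraMap K L (s j l))) +
        E (c j) * (algebraMap K L (ξ l) * algebraMap K L (s j l))) := fun l => by
    rw [hx, map_sum, Finset.mul_sum]
    refine Finset.sum_congr rfl fun j _ => ?_
    rw [E.leibniz, smul_eq_mul, smul_eq_mul, Algebra.smul_def (ξ l)]
    ring
  rw [Finset.sum_congr rfl fun l _ => h1 l, Finset.sum_comm]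
  refine Finset.sum_eq_zero fun j _ => ?_
  rw [Finset.sum_add_distrib, ← Finset.mul_sum, ← Finset.mul_sum,
    sum_smul_derivation_eq_zero (hder j) hξ, h0, mul_zero, mul_zero, add_zero]

/-- If all derivatives of the vectors `s j` lie in `U`, then the transcendence degree of any
combination of the `s j` with coefficients in a larger field is at most the dimension of `U`. -/
theorem card_le_finrank_of_algebraicIndependent [CharZero k] {s : ι → n → K} (hs : ∀ j, s j ∈ U)
    (hder : ∀ j, ∀ D : Derivation k K K, derVec D (s j) ∈ U) {c : ι → L} {x : n → L}
    (hx : ∀ l, x l = ∑ j, c j * algebraMap K L (s j l)) {d : ℕ} (p : Fin d → MvPolynomial n k)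
    (hp : AlgebraicIndependent k fun i => aeval x (p i)) : d ≤ Module.finrank K U := by
  choose D hD using exists_derivation_of_algebraicIndependent hp
  -- By the chain rule, the gradients of the `p j` at `x` form a dual family. These independent
  -- vectors are killed by `perp U`, which bounds their number.
  have hv : LinearIndependent L fun i l => D i (x l) := by
    refine linearIndependent_of_dotProduct (w := fun j l => aeval x (pderiv l (p j))) one_ne_zero
      fun i j => ?_
    have h := hD j i
    rw [derivation_aeval] at h
    refine Eq.trans ?_ (h.trans (if_congr eq_comm rfl rfl))
    rfl
  let μ := Module.finBasis K (perp U)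
  have hμL := linearIndependent_algebraMap (L := L)
    (μ.linearIndependent.map' (perp U).subtype (perp U).ker_subtype)
  have hle : Submodule.span L (Set.range fun i l => D i (x l)) ≤
      perp (Submodule.span L (Set.range fun i l => algebraMap K L ((μ i : n → K) l))) := by
    refine Submodule.span_le.2 ?_
    rintro _ ⟨i, rfl⟩ y hy
    induction hy using Submodule.span_induction with
    | mem y hy =>
      obtain ⟨j, rfl⟩ := hy
      rw [dotProduct_comm]
      exact sum_algebraMap_mul_derivation_eq_zero hs hder hx (μ j).2 (D i)
    | zero => exact dotProduct_zero _
    | add y z _ _ hy hz => rw [dotProduct_add, hy, hz, add_zero]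
    | smul a y _ hy => rw [dotProduct_smul, hy, smul_zero]
  have h1 := Submodule.finrank_mono hle
  rw [finrank_span_eq_card hv, Fintype.card_fin] at h1
  have h2 := finrank_add_finrank_perp
    (Submodule.span L (Set.range fun i l => algebraMap K L ((μ i : n → K) l)))
  have h4 := finrank_span_eq_card hμL
  rw [Fintype.card_fin] at h4
  have h5 : Module.finrank L (Submodule.span L
    (Set.range fun i l => algebraMap K L ((μ i : n → K) l))) = Module.finrank K (perp U) := h4
  have h3 := finrank_add_finrank_perp U
  omega

end GenericDimension

/-! ### Equations with a partial derivative outside the ideal. -/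

section Gradient

theorem pderiv_eq_zero_imp {σ k : Type*} [Field k] [CharZero k] {p : MvPolynomial σ k}
    (h : ∀ i, pderiv i p = 0) : p = C (coeff 0 p) := by
  classical
  ext α
  rw [coeff_C]
  split_ifs with hα
  · rw [hα]
  · obtain ⟨i, hi⟩ := Finsupp.ne_iff.1 (Ne.symm hα)
    have h1 := coeff_pderiv (i := i) p (α - Finsupp.single i 1)
    have h2 : α - Finsupp.single i 1 + Finsupp.single i 1 = α :=
      tsub_add_cancel_of_le (Finsupp.single_le_iff.2 (Nat.one_le_iff_ne_zero.2 hi))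
    rw [h, coeff_zero, h2] at h1
    exact (mul_eq_zero.1 h1.symm).resolve_right (Nat.cast_add_one_ne_zero _)

theorem totalDegree_pderiv_lt {σ k : Type*} [Field k] [CharZero k] {p : MvPolynomial σ k} {i : σ}
    (h : pderiv i p ≠ 0) : (pderiv i p).totalDegree < p.totalDegree := by
  obtain ⟨α, hα, hdeg⟩ := Finset.exists_mem_eq_sup _ (support_nonempty.2 h)
    fun s : σ →₀ ℕ => s.sum fun _ e => e
  rw [mem_support_iff, coeff_pderiv] at hα
  have h1 := le_totalDegree (mem_support_iff.2 (left_ne_zero_of_mul hα))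
  have h2 : (pderiv i p).totalDegree = α.sum fun _ e => e := hdeg
  rw [Finsupp.sum_add_index' (fun _ => rfl) (fun _ _ _ => rfl), Finsupp.sum_single_index rfl] at h1
  omega

/-- A nonzero proper ideal of polynomials contains one with a partial derivative outside it. -/
theorem exists_pderiv_notMem {σ k : Type*} [Field k] [CharZero k] {J : Ideal (MvPolynomial σ k)}
    (h0 : J ≠ ⊥) (h1 : J ≠ ⊤) : ∃ p ∈ J, ∃ i, pderiv i p ∉ J := by
  obtain ⟨p₀, hp₀, hne₀⟩ := Submodule.exists_mem_ne_zero_of_ne_bot h0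
  by_contra! hcon
  -- Differentiation lowers the degree, so an ideal stable under all partial derivatives would
  -- contain a nonzero constant.
  have key : ∀ d : ℕ, ∀ p ∈ J, p ≠ 0 → p.totalDegree ≤ d → False := by
    intro d
    induction d with
    | zero =>
      intro p hp hne hd
      rw [totalDegree_eq_zero_iff_eq_C.1 (Nat.le_zero.1 hd)] at hp hne
      have hc : coeff 0 p ≠ 0 := fun h => hne (by rw [h, C_0])
      exact h1 (Ideal.eq_top_of_isUnit_mem _ hp ((IsUnit.mk0 _ hc).map C))
    | succ d ih =>
      intro p hp hne hd
      by_cases hall : ∀ i, pderiv i p = 0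
      · rw [pderiv_eq_zero_imp hall] at hp hne
        have hc : coeff 0 p ≠ 0 := fun h => hne (by rw [h, C_0])
        exact h1 (Ideal.eq_top_of_isUnit_mem _ hp ((IsUnit.mk0 _ hc).map C))
      · push Not at hall
        obtain ⟨i, hi⟩ := hall
        exact ih _ (hcon p hp i) hi (by have := totalDegree_pderiv_lt hi; omega)
  exact key _ p₀ hp₀ hne₀ le_rfl

theorem dirDeriv_aeval {m n : ℕ} (b v : Fin m → ℂ) (f : Fin n → MvPolynomial (Fin m) ℂ)
    (G : MvPolynomial (Fin n) ℂ) : dirDeriv b v (aeval f G) =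
      ∑ l, aeval (fun i => aeval b (f i)) (pderiv l G) * dirDeriv b v (f l) := by
  have h : ∀ e, aeval b (pderiv e (aeval f G)) =
      ∑ l, aeval (fun i => aeval b (f i)) (pderiv l G) * aeval b (pderiv e (f l)) := fun e => by
    rw [derivation_aeval, map_sum]
    exact Finset.sum_congr rfl fun l _ => by rw [smul_eq_mul, map_mul, comp_aeval_apply]
  simp only [dirDeriv, h, Finset.mul_sum]
  rw [Finset.sum_comm]
  exact Finset.sum_congr rfl fun l _ => Finset.sum_congr rfl fun e _ => by ring

end Gradient

/-! ### The tangential scroll of a hypersurface consists of hyperplanes. -/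

section Spread

variable {m : ℕ} {I : Ideal (MvPolynomial (Fin m) ℂ)} [hI : I.IsPrime] {N : ℕ}

namespace ParametricScroll

variable (X : ParametricScroll I N)

/-- The point of the spread with indeterminate fibre coordinates. -/
def fibrePoint (i : Fin (N + 1)) : MvPolynomial (Fin (X.k + 1)) (MvPolynomial (Fin m) ℂ) :=
  ∑ j, MvPolynomial.X j * C (X.frame j i)

/-- The field of rational functions on the total space of the bundle of fibres. -/
abbrev TotalField : Type := FractionRing (MvPolynomial (Fin (X.k + 1)) (FunctionField I))

/-- The generic point of the spread. -/
def genericPoint (i : Fin (N + 1)) : X.TotalField :=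
  ∑ j, algebraMap (MvPolynomial (Fin (X.k + 1)) (FunctionField I)) X.TotalField (MvPolynomial.X j) *
    algebraMap (FunctionField I) X.TotalField (toFF I (X.frame j i))

theorem aeval_spreadMap (b : Fin m → ℂ) (a : Fin (X.k + 1) → ℂ)
    (p : MvPolynomial (Fin (N + 1)) ℂ) :
    aeval (X.spreadMap b a) p = aeval a (mapAlgHom (aeval b) (aeval X.fibrePoint p)) := by
  rw [comp_aeval_apply, comp_aeval_apply]
  congr 1
  congr 1
  funext i
  simp [fibrePoint, spreadMap]

theorem aeval_genericPoint (p : MvPolynomial (Fin (N + 1)) ℂ) :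
    aeval X.genericPoint p = algebraMap _ X.TotalField
      (mapAlgHom (toFF I) (aeval X.fibrePoint p)) := by
  rw [comp_aeval_apply]
  change _ = IsScalarTower.toAlgHom ℂ _ X.TotalField _
  rw [comp_aeval_apply]
  congr 1
  congr 1
  funext i
  simp only [fibrePoint, genericPoint, IsScalarTower.coe_toAlgHom', mapAlgHom_apply, map_sum,
    map_mul, map_X, map_C]
  refine Finset.sum_congr rfl fun j _ => ?_
  rw [IsScalarTower.algebraMap_apply (FunctionField I)
    (MvPolynomial (Fin (X.k + 1)) (FunctionField I)) X.TotalField]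
  rfl

theorem aeval_genericPoint_eq_zero {p : MvPolynomial (Fin (N + 1)) ℂ} :
    aeval X.genericPoint p = 0 ↔ ∀ α, coeff α (aeval X.fibrePoint p) ∈ I := by
  rw [aeval_genericPoint, map_eq_zero_iff _ (IsFractionRing.injective _ _), MvPolynomial.ext_iff]
  refine forall_congr' fun α => ?_
  rw [mapAlgHom_apply, coeff_map, coeff_zero]
  exact toFF_eq_zero

/-- Expand `p` on the spread in the fibre coordinates: its coefficients are polynomials on the base,
and by the Nullstellensatz they vanish at all points exactly when they lie in `I`. -/
theorem mem_vanishingIdeal_spread {p : MvPolynomial (Fin (N + 1)) ℂ} :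
    p ∈ vanishingIdeal ℂ X.spread ↔ aeval X.genericPoint p = 0 := by
  rw [aeval_genericPoint_eq_zero]
  constructor
  · intro hp α
    refine mem_of_forall_zeroLocus hI fun b hb => ?_
    have h1 : mapAlgHom (aeval b) (aeval X.fibrePoint p) = 0 := MvPolynomial.funext fun a => by
      have h2 := hp _ ⟨b, hb, a, rfl⟩
      rw [aeval_spreadMap] at h2
      rw [map_zero]
      exact (RingHom.congr_fun (coe_aeval_eq_eval a) _).symm.trans h2
    have h3 := congrArg (coeff α) h1
    rwa [mapAlgHom_apply, coeff_map, coeff_zero] at h3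
  · rintro h _ ⟨b, hb, a, rfl⟩
    rw [aeval_spreadMap, show mapAlgHom (aeval b) (aeval X.fibrePoint p) = 0 from ?_, map_zero]
    ext α
    rw [mapAlgHom_apply, coeff_map, coeff_zero]
    exact hb _ (h α)

theorem vanishingIdeal_spread : vanishingIdeal ℂ X.spread =
    RingHom.ker (aeval (R := ℂ) X.genericPoint) := Ideal.ext fun _ => X.mem_vanishingIdeal_spread

instance : (vanishingIdeal ℂ X.spread).IsPrime := by
  rw [vanishingIdeal_spread]
  exact RingHom.ker_isPrime _

/-- The homogeneous coordinate ring of the closure of the spread, as functions on the total space. -/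
def coordinateRingHom :
    (MvPolynomial (Fin (N + 1)) ℂ ⧸ vanishingIdeal ℂ X.spread) →ₐ[ℂ] X.TotalField :=
  Ideal.Quotient.liftₐ _ (aeval X.genericPoint) fun _ hp => X.mem_vanishingIdeal_spread.1 hp

theorem coordinateRingHom_mk (p : MvPolynomial (Fin (N + 1)) ℂ) :
    X.coordinateRingHom (Ideal.Quotient.mk _ p) = aeval X.genericPoint p := rfl

theorem coordinateRingHom_injective : Function.Injective X.coordinateRingHom := by
  refine (injective_iff_map_eq_zero _).2 fun s hs => ?_
  obtain ⟨p, rfl⟩ := Ideal.Quotient.mk_surjective s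
  exact Ideal.Quotient.eq_zero_iff_mem.2 (X.mem_vanishingIdeal_spread.2 hs)

variable {X} {T : ParametricScroll I N}

/-- The cone over the spread carries `d + 1` algebraically independent functions of the generic
point, which is a combination of frame vectors whose derivatives lie in the space of `T`. -/
theorem HasProjDim.le_finrank {d : ℕ} (h : HasProjDim X.spread d) (hT : X.IsDerived T) :
    d + 1 ≤ Module.finrank (FunctionField I) (spanFF I T.frame) := by
  obtain ⟨n, x, hx, hn, -⟩ := exists_algebraicIndependent_of_finiteType ℂ
    (MvPolynomial (Fin (N + 1)) ℂ ⧸ vanishingIdeal ℂ X.spread)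
  have hnd : n = d + 1 := by
    rw [HasProjDim, hn] at h
    exact_mod_cast h
  choose p hp using fun i => Ideal.Quotient.mk_surjective (x i)
  have hx' := hx.map' X.coordinateRingHom_injective
  rw [show X.coordinateRingHom ∘ x = fun i => aeval X.genericPoint (p i) from
    funext fun i => by rw [Function.comp_apply, ← hp]; rfl] at hx'
  have hd := hT.isDerivedSpace
  rw [← hnd]
  exact card_le_finrank_of_algebraicIndependent (K := FunctionField I)
    (s := fun j i => toFF I (X.frame j i)) (fun j => hd.le (Submodule.subset_span ⟨j, rfl⟩))
    (fun j => hd.derVec_mem _ (Submodule.subset_span ⟨j, rfl⟩)) (fun _ => rfl) p hx'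

/-- Differentiate `G` separately in two directions: on the fibre over `b` it is zero as a polynomial
in `a`, and on the section with constant `a` it lies in `I`, so tangent vectors kill it. -/
theorem spreadDiff_dotProduct_gradient {b v : Fin m → ℂ} (hb : b ∈ zeroLocus ℂ I)
    (hv : v ∈ tangentSpace I b) (a c : Fin (X.k + 1) → ℂ) {G : MvPolynomial (Fin (N + 1)) ℂ}
    (hG : G ∈ vanishingIdeal ℂ X.spread) :
    ∑ l, aeval (X.spreadMap b a) (pderiv l G) * X.spreadDiff b a (v, c) l = 0 := by
  have h1 := dirDeriv_aeval a c
    (fun i => ∑ j, MvPolynomial.X j * C (aeval b (X.frame j i))) G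
  have h2 := dirDeriv_aeval b v (fun i => ∑ j, C (a j) * X.frame j i) G
  have e1 : (aeval fun i => ∑ j, MvPolynomial.X j * C (aeval b (X.frame j i))) G =
      (0 : MvPolynomial (Fin (X.k + 1)) ℂ) := MvPolynomial.funext fun a' => by
    have h3 := hG _ ⟨b, hb, a', rfl⟩
    rw [map_zero, ← h3, ← coe_aeval_eq_eval]
    change aeval a' _ = _
    rw [comp_aeval_apply]
    congr 2
    funext i
    simp [spreadMap]
  have e2 : (aeval fun i => ∑ j, C (a j) * X.frame j i) G ∈ I :=
    mem_of_forall_zeroLocus hI fun b' hb' => by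
      have h3 := hG _ ⟨b', hb', a, rfl⟩
      rw [← h3, comp_aeval_apply]
      congr 2
      funext i
      simp [spreadMap]
  have p1 : (fun i => aeval a (∑ j, MvPolynomial.X j * C (aeval b (X.frame j i)))) =
      X.spreadMap b a := by
    funext i
    simp [spreadMap]
  have p2 : (fun i => aeval b (∑ j, C (a j) * X.frame j i)) = X.spreadMap b a := by
    funext i
    simp [spreadMap]
  rw [hv _ e2, p2] at h2
  rw [e1, p1] at h1
  have h0 : dirDeriv a c (0 : MvPolynomial (Fin (X.k + 1)) ℂ) = 0 := by simp [dirDeriv]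
  rw [h0] at h1
  have h3 := congrArg₂ (· + ·) h1 h2
  simp only [← Finset.sum_add_distrib, ← mul_add] at h3
  rw [add_zero] at h3
  rw [h3]
  refine Finset.sum_congr rfl fun l _ => ?_
  congr 1
  rw [spreadDiff_apply]
  have q1 : dirDeriv a c (∑ j, MvPolynomial.X j * C (aeval b (X.frame j l))) =
      ∑ j, c j * aeval b (X.frame j l) := by
    simp [dirDeriv, pderiv_X, Pi.single_apply, mul_comm]
  have q2 : dirDeriv b v (∑ j, C (a j) * X.frame j l) =
      ∑ j, a j * dirDeriv b v (X.frame j l) := by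
    simp only [dirDeriv, map_sum, (pderiv _).leibniz, pderiv_C, smul_eq_mul, mul_zero, add_zero,
      map_mul, aeval_C, Finset.mul_sum]
    rw [Finset.sum_comm]
    refine Finset.sum_congr rfl fun j _ => Finset.sum_congr rfl fun e _ => ?_
    simp only [Algebra.algebraMap_self, RingHom.id_apply]
    ring
  rw [q1, q2]
  simp

/-- Some equation of the spread has a partial derivative not vanishing identically on it; its
gradient at a general point is a nonzero functional killing the tangent space. -/
theorem finrank_le_of_vanishingIdeal_ne_bot (h : vanishingIdeal ℂ X.spread ≠ ⊥)
    (hT : X.IsDerived T) : Module.finrank (FunctionField I) (spanFF I T.frame) ≤ N := by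
  obtain ⟨G, hG, l, hl⟩ := exists_pderiv_notMem h
    (inferInstance : (vanishingIdeal ℂ X.spread).IsPrime).ne_top
  rw [mem_vanishingIdeal_spread, aeval_genericPoint_eq_zero] at hl
  push Not at hl
  obtain ⟨α, hα⟩ := hl
  obtain ⟨b, hb, ⟨hbα, hbT⟩, hbr⟩ := (((generally_ne_zero hα).and hI hT.2).and hI
    (generally_finrank_eq T.frame)).exists hI
  have hvec : GenerallyVec fun a : Fin (X.k + 1) → ℂ =>
      aeval (X.spreadMap b a) (pderiv l G) ≠ 0 := by
    refine ⟨mapAlgHom (aeval b) (aeval X.fibrePoint (pderiv l G)), fun h0 => hbα ?_, fun a ha => ?_⟩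
    · have h1 := congrArg (coeff α) h0
      rwa [mapAlgHom_apply, coeff_map, coeff_zero] at h1
    · change aeval _ _ ≠ 0
      rwa [aeval_spreadMap]
  obtain ⟨a, haT, ha⟩ := hbT.exists hvec
  have hle : X.tangent b a ≤
      perp (Submodule.span ℂ {fun l => aeval (X.spreadMap b a) (pderiv l G)}) := by
    rintro _ ⟨⟨v, c⟩, ⟨hv, -⟩, rfl⟩ y hy
    obtain ⟨r, rfl⟩ := Submodule.mem_span_singleton.1 hy
    rw [dotProduct_smul, dotProduct_comm, dotProduct,
      spreadDiff_dotProduct_gradient hb hv a c hG, smul_zero]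
  have h1 := Submodule.finrank_mono hle
  have h2 := finrank_add_finrank_perp
    (Submodule.span ℂ {fun l => aeval (X.spreadMap b a) (pderiv l G)})
  rw [finrank_span_singleton (fun h0 => ha (congrFun h0 l)), Fintype.card_fin] at h2
  rw [← hbr]
  change Module.finrank ℂ (T.fibre b) ≤ N
  rw [haT]
  omega

/-- The tangential scroll of a stationary hypersurface consists of hyperplanes. -/
theorem IsHypersurface.finrank_eq (h : X.IsHypersurface) (hT : X.IsDerived T) :
    Module.finrank (FunctionField I) (spanFF I T.frame) = N := by
  obtain ⟨d, hd, hdim⟩ := h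
  refine le_antisymm (finrank_le_of_vanishingIdeal_ne_bot (fun h0 => ?_) hT)
    (hd.symm.le.trans (HasProjDim.le_finrank hdim hT))
  -- With no equations the cone would have dimension `N + 1` instead of `d + 1 = N`.
  rw [HasProjDim, h0, ringKrullDim_eq_of_ringEquiv (RingEquiv.quotientBot _),
    MvPolynomial.ringKrullDim_of_isNoetherianRing, ringKrullDim_eq_zero_of_field] at hdim
  rw [Nat.card_fin, zero_add] at hdim
  have : N + 1 = d + 1 := by exact_mod_cast hdim
  omega

end ParametricScroll

end Spread

/-! ### The field of coordinate ratios of a rational map. -/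

section RatioField

variable {K : Type*} [Field K] [Algebra ℂ K] {n : Type*}

/-- The field of rational functions of the point with homogeneous coordinates `η`, generated by
the ratios with the coordinate `i₀`. -/
def ratioField (η : n → K) (i₀ : n) : IntermediateField ℂ K :=
  IntermediateField.adjoin ℂ (Set.range fun i => η i / η i₀)

/-- If the ratios of the coordinates of `η` generate a subfield of finite index, then the rational
map with coordinates `η` is an immersion. -/
theorem derivation_eq_zero_of_derVec_mem_span {η : n → K} {i₀ : n} (h0 : η i₀ ≠ 0)
    [Algebra.IsAlgebraic (ratioField η i₀) K] {D : Derivation ℂ K K}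
    (hD : derVec D η ∈ Submodule.span K {η}) : D = 0 := by
  obtain ⟨c, hc⟩ := Submodule.mem_span_singleton.1 hD
  have hc' : ∀ i, D (η i) = c * η i := fun i => (congrFun hc i).symm
  refine derivation_eq_zero_of_isAlgebraic (ratioField η i₀) D fun e he => ?_
  induction he using IntermediateField.adjoin_induction with
  | mem e he =>
    obtain ⟨i, rfl⟩ := he
    have h1 : η i₀ * (η i / η i₀) = η i := mul_div_cancel₀ _ h0
    have h2 := congrArg D h1
    rw [D.leibniz, hc', hc', smul_eq_mul, smul_eq_mul] at h2
    have h3 : η i₀ * D (η i / η i₀) = 0 := by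
      linear_combination h2 - c * h1
    exact (mul_eq_zero.1 h3).resolve_left h0
  | algebraMap x => exact D.map_algebraMap x
  | add x y _ _ hx hy => rw [map_add, hx, hy, add_zero]
  | inv x _ hx => rw [D.leibniz_inv, hx, smul_zero]
  | mul x y _ _ hx hy => rw [D.leibniz, hx, hy, smul_zero, smul_zero, add_zero]

/-- A rational map all of whose fibres near one point are finite makes the function field of the
source algebraic over the field generated by the coordinates of the map. -/
theorem isAlgebraic_of_finite_fibre {S K : Type} [CommRing S] [IsDomain S] [Field K] [Algebra ℂ S]
    [Algebra ℂ K] [Algebra S K] [IsScalarTower ℂ S K] [IsFractionRing S K] [Algebra.FiniteType ℂ S]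
    {ι : Type} (r : ι → S) (q : S →ₐ[ℂ] ℂ) (hq : {ψ : S →ₐ[ℂ] ℂ | ∀ i, ψ (r i) = q (r i)}.Finite)
    (E : IntermediateField ℂ K) (hE : ∀ i, algebraMap S K (r i) ∈ E) :
    Algebra.IsAlgebraic E K := by
  let R := MvPolynomial ι ℂ
  let f : R →ₐ[ℂ] S := aeval r
  let fK : R →ₐ[ℂ] K := (IsScalarTower.toAlgHom ℂ S K).comp f
  let fE : R →ₐ[ℂ] E := aeval fun i => (⟨_, hE i⟩ : E)
  let algRS : Algebra R S := f.toRingHom.toAlgebra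
  let algRK : Algebra R K := fK.toRingHom.toAlgebra
  let algRE : Algebra R E := fE.toRingHom.toAlgebra
  have : IsScalarTower ℂ R S := IsScalarTower.of_algebraMap_eq fun c => (f.commutes c).symm
  have : IsScalarTower R S K := IsScalarTower.of_algebraMap_eq fun _ => rfl
  have hcomp : fK = E.val.comp fE := MvPolynomial.algHom_ext fun i => by
    simp only [AlgHom.comp_apply, fK, f, fE, aeval_X]
    rfl
  have : IsScalarTower R E K :=
    IsScalarTower.of_algebraMap_eq fun x => DFunLike.congr_fun hcomp x
  have hquasi : Algebra.QuasiFinite R K := quasiFinite_of_finite_fibre q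
    (hq.subset fun ψ hψ i => by
      have h1 := hψ (X i)
      change ψ (f (X i)) = q (f (X i)) at h1
      rwa [show f (X i) = r i from aeval_X _ _] at h1)
  have hEK : Algebra.QuasiFinite E K := Algebra.QuasiFinite.of_restrictScalars R E K
  have : Module.Finite E K := Algebra.QuasiFinite.iff_of_isArtinianRing.1 hEK
  exact Algebra.IsAlgebraic.of_finite E K

/-- The ring generated by the homogeneous coordinates `τ * η i` has the transcendence degree of the
field generated by `τ` and `K`, if `K` is algebraic over the field of ratios. -/
theorem trdeg_eq_of_isAlgebraic_ratioField {S K L : Type} [CommRing S] [IsDomain S] [Field K]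
    [Field L] [Algebra ℂ S] [Algebra ℂ K] [Algebra ℂ L] [Algebra K L] [IsScalarTower ℂ K L]
    {σ : Type} [Algebra (MvPolynomial σ K) L] [IsFractionRing (MvPolynomial σ K) L]
    [IsScalarTower K (MvPolynomial σ K) L] {φ : S →ₐ[ℂ] L} (hφ : Function.Injective φ)
    {η : n → K} {i₀ : n} (h0 : η i₀ ≠ 0) [Algebra.IsAlgebraic (ratioField η i₀) K] {τ : L}
    (hτ : τ ≠ 0) {x : n → S} (hx : ∀ i, φ (x i) = τ * algebraMap K L (η i))
    (hX : ∀ j, algebraMap (MvPolynomial σ K) L (X j) = τ) :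
    Algebra.trdeg ℂ S = Algebra.trdeg ℂ L := by
  let algSL : Algebra S L := φ.toRingHom.toAlgebra
  have : IsScalarTower ℂ S L := IsScalarTower.of_algebraMap_eq fun c => (φ.commutes c).symm
  have : FaithfulSMul S L := (faithfulSMul_iff_algebraMap_injective S L).2 hφ
  have hα0 : algebraMap K L (η i₀) ≠ 0 := (map_ne_zero _).2 h0
  have hpt : ∀ i, IsAlgebraic S (τ * algebraMap K L (η i)) := fun i => by
    rw [← hx]
    exact isAlgebraic_algebraMap (x i)
  have hE : ∀ e ∈ ratioField η i₀, IsAlgebraic S (algebraMap K L e) := fun e he => by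
    induction he using IntermediateField.adjoin_induction with
    | mem e he =>
      obtain ⟨i, rfl⟩ := he
      have h1 : algebraMap K L (η i / η i₀) =
          τ * algebraMap K L (η i) * (τ * algebraMap K L (η i₀))⁻¹ := by
        rw [map_div₀, ← div_eq_mul_inv, mul_div_mul_left _ _ hτ]
      rw [h1]
      exact (hpt i).mul (hpt i₀).inv
    | algebraMap x =>
      rw [← IsScalarTower.algebraMap_apply, IsScalarTower.algebraMap_apply ℂ S L]
      exact isAlgebraic_algebraMap _
    | add x y _ _ hx hy => rw [map_add]; exact hx.add hy
    | inv x _ hx => rw [map_inv₀]; exact hx.inv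
    | mul x y _ _ hx hy => rw [map_mul]; exact hx.mul hy
  have hK : ∀ x, IsAlgebraic S (algebraMap K L x) :=
    isAlgebraic_algebraMap_of_intermediateField (ratioField η i₀) hE
  have hτa : IsAlgebraic S τ := by
    rw [← mul_inv_cancel_right₀ hα0 τ]
    exact (hpt i₀).mul (hK _).inv
  have hpoly : ∀ p : MvPolynomial σ K, IsAlgebraic S (algebraMap _ L p) := fun p => by
    induction p using MvPolynomial.induction_on with
    | C a =>
      rw [← algebraMap_eq, ← IsScalarTower.algebraMap_apply]
      exact hK a
    | add p q hp hq => rw [map_add]; exact hp.add hq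
    | mul_X p j hp => rw [map_mul, hX]; exact hp.mul hτa
  have hL : Algebra.IsAlgebraic S L := ⟨fun x => by
    obtain ⟨p, q, -, rfl⟩ := IsFractionRing.div_surjective (A := MvPolynomial σ K) x
    rw [div_eq_mul_inv]
    exact (hpoly p).mul (hpoly q).inv⟩
  have h1 := trdeg_add_eq ℂ S (A := L)
  rwa [trdeg_eq_zero (R := S), add_zero] at h1

end RatioField

/-! ### Coordinate rings of basic open subsets and their points. -/

section Localized

variable {m : ℕ} (I : Ideal (MvPolynomial (Fin m) ℂ)) [hI : I.IsPrime]

/-- The ring of regular functions on the open subset `u ≠ 0` of the variety `V(I)`. -/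
def localizedRing (u : MvPolynomial (Fin m) ℂ) : Subalgebra ℂ (FunctionField I) :=
  Algebra.adjoin ℂ (insert (toFF I u)⁻¹ (Set.range fun l => toFF I (X l)))

variable {I} {u : MvPolynomial (Fin m) ℂ}

theorem toFF_mem_localizedRing (p : MvPolynomial (Fin m) ℂ) : toFF I p ∈ localizedRing I u := by
  rw [toFF_eq_aeval]
  have h : aeval (fun l => toFF I (X l)) p ∈ Algebra.adjoin ℂ (Set.range fun l => toFF I (X l)) := by
    rw [Algebra.adjoin_range_eq_range_aeval]
    exact ⟨p, rfl⟩
  exact Algebra.adjoin_mono (Set.subset_insert _ _) h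

theorem inv_mem_localizedRing : (toFF I u)⁻¹ ∈ localizedRing I u :=
  Algebra.subset_adjoin (Set.mem_insert _ _)

instance : Algebra.FiniteType ℂ (localizedRing I u) :=
  (Subalgebra.fg_iff_finiteType _).1 (Subalgebra.fg_def.2
    ⟨_, (Set.finite_range _).insert _, rfl⟩)

instance : IsFractionRing (localizedRing I u) (FunctionField I) :=
  IsFractionRing.of_field _ _ fun z => by
    obtain ⟨q, hq, p, hp⟩ := exists_common_denominator fun _ : Unit => z
    have hq0 : toFF I q ≠ 0 := fun h => hq (toFF_eq_zero.1 h)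
    refine ⟨⟨_, toFF_mem_localizedRing (p ())⟩, ⟨_, toFF_mem_localizedRing q⟩, ?_⟩
    change z = toFF I (p ()) / toFF I q
    rw [hp, mul_div_cancel_left₀ _ hq0]

/-- A polynomial as a regular function on an open subset. -/
def toLocalized (u : MvPolynomial (Fin m) ℂ) : MvPolynomial (Fin m) ℂ →ₐ[ℂ] localizedRing I u :=
  (toFF I).codRestrict _ toFF_mem_localizedRing

theorem toLocalized_mul_inv (hu : u ∉ I) :
    toLocalized u u * (⟨_, inv_mem_localizedRing⟩ : localizedRing I u) = 1 :=
  Subtype.ext (mul_inv_cancel₀ fun h => hu (toFF_eq_zero.1 h))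

/-- The point of affine space given by a `ℂ`-point of the localized ring. -/
def pointOf (ψ : localizedRing I u →ₐ[ℂ] ℂ) (l : Fin m) : ℂ := ψ (toLocalized u (X l))

theorem aeval_pointOf (ψ : localizedRing I u →ₐ[ℂ] ℂ) (p : MvPolynomial (Fin m) ℂ) :
    aeval (pointOf ψ) p = ψ (toLocalized u p) := by
  have h : aeval (pointOf ψ) = ψ.comp (toLocalized u) := MvPolynomial.algHom_ext fun l => by
    rw [aeval_X]
    rfl
  rw [h]
  rfl

theorem pointOf_mem (ψ : localizedRing I u →ₐ[ℂ] ℂ) : pointOf ψ ∈ zeroLocus ℂ I := fun p hp => by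
  rw [aeval_pointOf, show toLocalized (I := I) u p = 0 from Subtype.ext (toFF_eq_zero.2 hp),
    map_zero]

theorem aeval_pointOf_mul_inv (hu : u ∉ I) (ψ : localizedRing I u →ₐ[ℂ] ℂ) :
    aeval (pointOf ψ) u * ψ ⟨_, inv_mem_localizedRing⟩ = 1 := by
  rw [aeval_pointOf, ← map_mul, toLocalized_mul_inv hu, map_one]

theorem pointOf_injective (hu : u ∉ I) :
    Function.Injective (pointOf : (localizedRing I u →ₐ[ℂ] ℂ) → Fin m → ℂ) := by
  intro ψ φ h
  refine AlgHom.adjoin_ext fun x hx => ?_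
  rcases hx with rfl | ⟨l, rfl⟩
  · have h1 := aeval_pointOf_mul_inv hu ψ
    have h2 := aeval_pointOf_mul_inv hu φ
    rw [h] at h1
    exact mul_left_cancel₀ (left_ne_zero_of_mul_eq_one h2) (h1.trans h2.symm)
  · exact congrFun h l

end Localized

/-! ### Dual varieties and the reversal of osculating chains. -/

section Variety

variable {m : ℕ} {I : Ideal (MvPolynomial (Fin m) ℂ)} [hI : I.IsPrime] {N : ℕ}

namespace ParametricScroll

variable (Y : ParametricScroll I N)

/-- The first frame vector, over the function field. -/
def frameFF : Fin (N + 1) → FunctionField I := fun i => toFF I (Y.frame 0 i)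

variable {Y}

theorem eq_zero_of_k_eq_zero (hk : Y.k = 0) (j : Fin (Y.k + 1)) : j = 0 :=
  Fin.ext (by simp only [Fin.val_zero]; omega)

theorem spanAt_eq_span (hk : Y.k = 0) (b : Fin m → ℂ) :
    spanAt Y.frame b = Submodule.span ℂ {fun i => aeval b (Y.frame 0 i)} := by
  refine congrArg (Submodule.span ℂ) (Set.eq_singleton_iff_unique_mem.2 ⟨⟨0, rfl⟩, ?_⟩)
  rintro _ ⟨j, rfl⟩
  rw [eq_zero_of_k_eq_zero hk j]

variable (Y) in
theorem exists_frame_notMem : ∃ i, Y.frame 0 i ∉ I := by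
  obtain ⟨b, hb, hli⟩ := Y.indep.exists hI
  by_contra! hcon
  have h0 := hli.ne_zero (0 : Fin (Y.k + 1))
  refine h0 (funext fun i => ?_)
  exact hb _ (hcon i)

/-- A generically finite map to projective space makes the function field of the source finite over
that of the image. -/
theorem isAlgebraic_ratioField (hk : Y.k = 0) {i₀ : Fin (N + 1)} (h0 : Y.frame 0 i₀ ∉ I) :
    Algebra.IsAlgebraic (ratioField Y.frameFF i₀) (FunctionField I) := by
  obtain ⟨h, hh, hfin⟩ := Y.genFinite
  have hη : Y.frameFF i₀ ≠ 0 := fun h1 => h0 (toFF_eq_zero.1 h1)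
  -- Inverting `h` keeps to the open set with finite fibres, and inverting the coordinate makes the
  -- ratios regular. Only `u` is inverted, hence the extra factor `h` in the numerators of `r`.
  let u := h * Y.frame 0 i₀
  have hu : u ∉ I := fun h1 => (hI.mem_or_mem h1).elim hh h0
  have hh0 : toFF I h ≠ 0 := fun h1 => hh (toFF_eq_zero.1 h1)
  let S := localizedRing I u
  let r : Fin (N + 1) → S := fun i =>
    toLocalized u (h * Y.frame 0 i) * ⟨_, inv_mem_localizedRing⟩
  have hr : ∀ i, (r i : FunctionField I) = Y.frameFF i / Y.frameFF i₀ := fun i => by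
    change toFF I (h * Y.frame 0 i) * (toFF I (h * Y.frame 0 i₀))⁻¹ =
      toFF I (Y.frame 0 i) / toFF I (Y.frame 0 i₀)
    rw [map_mul, map_mul, ← div_eq_mul_inv, mul_div_mul_left _ _ hh0]
  obtain ⟨M, hM⟩ := Ideal.exists_maximal S
  obtain ⟨q, -⟩ := exists_algHom_ker_eq M
  have hval : ∀ (ψ : S →ₐ[ℂ] ℂ) i, ψ (r i) * aeval (pointOf ψ) u =
      aeval (pointOf ψ) (h * Y.frame 0 i) := fun ψ i => by
    rw [map_mul ψ, ← aeval_pointOf, mul_assoc, mul_comm (ψ _), aeval_pointOf_mul_inv hu, mul_one]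
  have hu0 : ∀ ψ : S →ₐ[ℂ] ℂ, aeval (pointOf ψ) u ≠ 0 := fun ψ =>
    left_ne_zero_of_mul_eq_one (aeval_pointOf_mul_inv hu ψ)
  have hne : ∀ ψ : S →ₐ[ℂ] ℂ, aeval (pointOf ψ) h ≠ 0 ∧ aeval (pointOf ψ) (Y.frame 0 i₀) ≠ 0 :=
    fun ψ => by
      have := hu0 ψ
      rw [map_mul] at this
      exact ⟨left_ne_zero_of_mul this, right_ne_zero_of_mul this⟩
  have hrat : ∀ (ψ : S →ₐ[ℂ] ℂ) i, ψ (r i) * aeval (pointOf ψ) (Y.frame 0 i₀) =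
      aeval (pointOf ψ) (Y.frame 0 i) := fun ψ i => by
    have h1 := hval ψ i
    rw [map_mul (aeval _), map_mul (aeval _)] at h1
    refine mul_left_cancel₀ (hne ψ).1 ?_
    rw [← h1]
    ring
  have hspan : ∀ ψ : S →ₐ[ℂ] ℂ, spanAt Y.frame (pointOf ψ) =
      Submodule.span ℂ {fun i => ψ (r i)} := fun ψ => by
    rw [spanAt_eq_span hk, ← Submodule.span_singleton_smul_eq (IsUnit.mk0 _ (hne ψ).2) fun i => ψ (r i)]
    congr 2
    funext i
    rw [Pi.smul_apply, smul_eq_mul, mul_comm, hrat]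
  refine isAlgebraic_of_finite_fibre r q ?_ _ fun i => ?_
  · refine Set.Finite.of_injOn (f := pointOf) (fun ψ hψ => ?_) (pointOf_injective hu).injOn
      (hfin (pointOf q) (pointOf_mem q) (hne q).1)
    refine ⟨pointOf_mem ψ, (hne ψ).1, ?_⟩
    rw [hspan, hspan]
    congr 2
    exact funext hψ
  · refine IntermediateField.subset_adjoin _ _ ⟨i, ?_⟩
    exact (hr i).symm

theorem genericPoint_of_k_eq_zero (hk : Y.k = 0) : ∃ τ : Y.TotalField, τ ≠ 0 ∧
    (∀ i, Y.genericPoint i = τ * algebraMap (FunctionField I) Y.TotalField (Y.frameFF i)) ∧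
    ∀ j, algebraMap (MvPolynomial (Fin (Y.k + 1)) (FunctionField I)) Y.TotalField
      (MvPolynomial.X j) = τ := by
  refine ⟨algebraMap (MvPolynomial (Fin (Y.k + 1)) (FunctionField I)) Y.TotalField
    (MvPolynomial.X 0), ?_, fun i => ?_, fun j => by rw [eq_zero_of_k_eq_zero hk j]⟩
  · rw [Ne, map_eq_zero_iff _ (IsFractionRing.injective _ _)]
    exact X_ne_zero 0
  · rw [genericPoint, Fintype.sum_eq_single 0 fun j hj => absurd (eq_zero_of_k_eq_zero hk j) hj]
    rfl

/-- The extra one is the single fibre coordinate, the scale of the homogeneous coordinates. -/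
theorem trdeg_totalField (hk : Y.k = 0) {g : ℕ}
    (hg : ringKrullDim (MvPolynomial (Fin m) ℂ ⧸ I) = (g : WithBot ℕ∞)) :
    Algebra.trdeg ℂ Y.TotalField = (g + 1 : ℕ) := by
  obtain ⟨n, -, -, hn, htr⟩ := exists_algebraicIndependent_of_finiteType ℂ
    (MvPolynomial (Fin m) ℂ ⧸ I)
  have hng : n = g := by
    rw [hn] at hg
    exact_mod_cast hg
  have : Algebra.IsAlgebraic (MvPolynomial (Fin m) ℂ ⧸ I) (FunctionField I) :=
    (IsFractionRing.comap_isAlgebraic_iff (K := FunctionField I)).2 inferInstance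
  have : Algebra.IsAlgebraic (MvPolynomial (Fin (Y.k + 1)) (FunctionField I)) Y.TotalField :=
    (IsFractionRing.comap_isAlgebraic_iff (K := Y.TotalField)).2 inferInstance
  have h1 := trdeg_add_eq ℂ (MvPolynomial (Fin m) ℂ ⧸ I) (A := FunctionField I)
  rw [htr, hng, trdeg_eq_zero (R := MvPolynomial (Fin m) ℂ ⧸ I), add_zero] at h1
  have h2 := trdeg_add_eq (FunctionField I) (MvPolynomial (Fin (Y.k + 1)) (FunctionField I))
    (A := Y.TotalField)
  rw [MvPolynomial.trdeg_of_isDomain,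
    trdeg_eq_zero (R := MvPolynomial (Fin (Y.k + 1)) (FunctionField I)), add_zero] at h2
  have h3 := trdeg_add_eq ℂ (FunctionField I) (A := Y.TotalField)
  rw [← h1, ← h2] at h3
  rw [← h3, hk]
  simp

/-- The image of a generically finite map to projective space has the dimension of the source. -/
theorem isVarietyOfDim (hk : Y.k = 0) {g : ℕ}
    (hg : ringKrullDim (MvPolynomial (Fin m) ℂ ⧸ I) = (g : WithBot ℕ∞)) : Y.IsVarietyOfDim g := by
  refine ⟨hk, ?_⟩
  obtain ⟨i₀, h0⟩ := Y.exists_frame_notMem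
  have hη : Y.frameFF i₀ ≠ 0 := fun h1 => h0 (toFF_eq_zero.1 h1)
  have := isAlgebraic_ratioField hk h0
  obtain ⟨τ, hτ, hgen, hX⟩ := genericPoint_of_k_eq_zero hk
  have h1 := trdeg_eq_of_isAlgebraic_ratioField (σ := Fin (Y.k + 1)) Y.coordinateRingHom_injective
    hη hτ (x := fun i => Ideal.Quotient.mk _ (X i))
    (fun i => ((Y.coordinateRingHom_mk _).trans (aeval_X _ _)).trans (hgen i)) hX
  obtain ⟨n, -, -, hn, htr⟩ := exists_algebraicIndependent_of_finiteType ℂ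
    (MvPolynomial (Fin (N + 1)) ℂ ⧸ vanishingIdeal ℂ Y.spread)
  rw [htr, trdeg_totalField hk hg] at h1
  have h2 : n = g + 1 := by exact_mod_cast h1
  rw [HasProjDim, ← h2]
  exact hn

theorem frameFF_ne_zero : Y.frameFF ≠ 0 := fun h => by
  obtain ⟨i, hi⟩ := Y.exists_frame_notMem
  exact hi (toFF_eq_zero.1 (congrFun h i))

/-- The dual of the tangential scroll of a hypersurface is a variety, and its tangential scroll is
the dual of the hypersurface. -/
theorem IsHypersurface.exists_dual_variety {Z : ParametricScroll I N} {g : ℕ}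
    (hZ : Z.IsHypersurface) (hg : Z.HasGaussDim g) :
    ∃ Y W T : ParametricScroll I N, Y.IsVarietyOfDim g ∧ Y.IsDerived W ∧ Z.IsLinearDual W ∧
      spanFF I W.frame = perp (spanFF I Z.frame) ∧ Z.IsDerived T ∧
      ∃ η ∈ perp (spanFF I T.frame), ∃ x ∈ spanFF I Z.frame, HasNondegeneratePairing ℂ η x := by
  obtain ⟨hdim, T, hT⟩ := hg
  have hN := hZ.finrank_eq hT
  have h1 := finrank_add_finrank_perp (spanFF I T.frame)
  rw [hN, Fintype.card_fin] at h1
  have hperp : Module.finrank (FunctionField I) (perp (spanFF I T.frame)) = 1 := by omega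
  have hne : perp (spanFF I T.frame) ≠ ⊥ := fun h => by
    rw [h, finrank_bot] at hperp
    exact zero_ne_one hperp
  -- The dual variety is the linear dual of the tangential scroll, whose fibres are hyperplanes; it
  -- inherits generic finiteness from the Gauss map.
  obtain ⟨Y, hY, -, hYk⟩ := T.exists_dual hne
  have hk : Y.k = 0 := by omega
  have hTd := hT.isDerivedSpace
  obtain ⟨i₀, h0⟩ := Y.exists_frame_notMem
  have := isAlgebraic_ratioField hk h0
  have hη : Y.frameFF ∈ perp (spanFF I T.frame) := by
    rw [← hY]
    exact Submodule.subset_span ⟨0, rfl⟩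
  obtain ⟨x, hx, hnd⟩ := hTd.exists_nondegeneratePairing (by rw [hN, Fintype.card_fin]) hη
    frameFF_ne_zero fun D hD => derivation_eq_zero_of_derVec_mem_span
      (η := Y.frameFF) (i₀ := i₀) (fun h => h0 (toFF_eq_zero.1 h)) hD
  obtain ⟨W, hW, hWd, -⟩ := Z.exists_dual fun h => hne (le_bot_iff.1 (h ▸ perp_antitone hTd.le))
  refine ⟨Y, W, T, isVarietyOfDim hk hdim, isDerived_of_isDerivedSpace ?_, hWd, hW, hT,
    _, hη, x, hx, hnd⟩
  rw [hY, hW]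
  exact hTd.perp hη hx hnd

/-- Duality reverses a chain of osculating scrolls. -/
theorem IsOsculating.exists_dual {i : ℕ} {X Z : ParametricScroll I N} (h : IsOsculating i X Z)
    {n : ℕ} {Y W : ParametricScroll I N} (hYW : IsOsculating n Y W) (hZW : Z.IsLinearDual W)
    (hW : spanFF I W.frame = perp (spanFF I Z.frame)) (hne : perp (spanFF I Z.frame) ≠ ⊥)
    {U' : Submodule (FunctionField I) (Fin (N + 1) → FunctionField I)}
    (hU' : IsDerivedSpace ℂ (spanFF I Z.frame) U') {η x : Fin (N + 1) → FunctionField I}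
    (hη : η ∈ perp U') (hx : x ∈ spanFF I Z.frame) (hnd : HasNondegeneratePairing ℂ η x) :
    ∃ W', IsOsculating (i + n) Y W' ∧ X.IsLinearDual W' := by
  -- Each step shortens the chain from `X` by one and lengthens the one from `Y`. The nondegenerate
  -- pairing is carried along, since it makes the next dual step a derived scroll.
  induction h generalizing n W U' η x with
  | zero X => exact ⟨W, by rwa [zero_add], hZW⟩
  | @succ i X Z T hXZ hZT ih =>
    have hd := hZT.isDerivedSpace
    obtain ⟨η', hη', u, hu, hnd'⟩ := hd.exists_nondegeneratePairing_pred hU' hη hx hnd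
    have hne' : perp (spanFF I Z.frame) ≠ ⊥ := fun h =>
      hne (le_bot_iff.1 (h ▸ perp_antitone hd.le))
    obtain ⟨W', hW', hWd, -⟩ := Z.exists_dual hne'
    have hder : W.IsDerived W' := isDerived_of_isDerivedSpace (by
      rw [hW, hW']
      exact hd.perp hη' hu hnd')
    obtain ⟨V, hV, hXV⟩ := ih (hYW.succ hder) hWd hW' hne' hd hη' hu hnd'
    exact ⟨V, by rwa [add_right_comm, add_assoc], hXV⟩

/-- The hypersurface end of the chain supplies `Y`, the first dual step and its pairing; reversing
the remaining `i` steps gives `i + 1` in all. -/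
theorem IsHypersurface.exists_osculating_dual {i g : ℕ} {X Z : ParametricScroll I N}
    (h : IsOsculating i X Z) (hZ : Z.IsHypersurface) (hg : Z.HasGaussDim g) :
    ∃ Y W : ParametricScroll I N,
      Y.IsVarietyOfDim g ∧ IsOsculating (i + 1) Y W ∧ X.IsLinearDual W := by
  obtain ⟨Y, W, T, hY, hYW, hZW, hW, hT, η, hη, x, hx, hnd⟩ := hZ.exists_dual_variety hg
  have hne : perp (spanFF I Z.frame) ≠ ⊥ := by
    rw [← hW, Submodule.ne_bot_iff]
    exact ⟨_, Submodule.subset_span ⟨0, rfl⟩, W.frameFF_ne_zero⟩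
  obtain ⟨V, hV, hXV⟩ := h.exists_dual ((IsOsculating.zero Y).succ hYW) hZW hW hne
    hT.isDerivedSpace hη hx hnd
  exact ⟨Y, V, hY, hV, hXV⟩

end ParametricScroll

end Variety

end Scroll

end

theorem mainTheorem11 {m N g : ℕ} (I : Ideal (MvPolynomial (Fin m) ℂ)) (hI : I.IsPrime)
    (X : Scroll.ParametricScroll I N) (hX : X.IsStationary) (hg : X.HasGaussDim g) :
    (X.IsHypersurface →
      ∃ Y W : Scroll.ParametricScroll I N,
        Y.IsVarietyOfDim g ∧ Y.IsDerived W ∧ X.IsLinearDual W) ∧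
    (∀ (i : ℕ) (Z : Scroll.ParametricScroll I N),
      Scroll.ParametricScroll.IsOsculating i X Z → Z.IsHypersurface →
      Z.IsStationary → Z.HasGaussDim g →
      ∃ Y W : Scroll.ParametricScroll I N,
        Y.IsVarietyOfDim g ∧ Scroll.ParametricScroll.IsOsculating (i + 1) Y W ∧
          X.IsLinearDual W) := by
  refine ⟨fun h => ?_, fun i Z hXZ hZ _ hZg => hZ.exists_osculating_dual hXZ hZg⟩
  obtain ⟨Y, W, -, hY, hYW, hXW, -⟩ := h.exists_dual_variety hg
  exact ⟨Y, W, hY, hYW, hXW⟩
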